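/- Let $Fm$ be the set of formulas built from a countably infinite set $Prop$ of propositional variables with the connectives of Hájek's Basic Logic ($*$, $\to$, $0$; abbreviations $\varphi\wedge\psi:=\varphi*(\varphi\to\psi)$, $\varphi\vee\psi:=((\varphi\to\psi)\to\psi)\wedge((\psi\to\varphi)\to\varphi)$, $\neg\varphi:=\varphi\to 0$, $1:=0\to 0$, $\varphi\equiv\psi:=(\varphi\to\psi)\wedge(\psi\to\varphi)$) and two unary connectives $\square,\lozenge$. Let $k$ be a natural number. *The calculus $\mathrm{S5}_k(\mathcal L)$.* Its axioms are all instances in $Fm$ of the axiom schemata of infinite-valued Łukasiewicz logic (Hájek's axioms of Basic Logic together with $\neg\neg\varphi\to\varphi$), all formulas $$\square\varphi\to\varphi,\quad \varphi\to\lozenge\varphi,\quad \square(\nu\to\varphi)\to(\nu\to\square\varphi),\quad \square(\varphi\to\nu)\to(\lozenge\varphi\to\nu),$$ $$\square(\varphi\vee\nu)\to(\square\varphi\vee\nu),\quad \lozenge(\varphi*\varphi)\equiv(\lozenge\varphi)*(\lozenge\varphi),$$ where $\varphi$ is any formula and $\nu$ is any propositional combination of formulas beginning with $\square$ or $\lozenge$,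 and all instances of the width axiom $$\bigwedge_{1\le i<j\le k+1}\square(\varphi_i\vee\varphi_j)\to\bigvee_{i=1}^{k+1}\square\varphi_i \tag{$W_k$}$$ (an empty conjunction is $1$). Its rules are Modus Ponens and Necessitation ($\varphi/\square\varphi$), and $\Gamma\vdash_{\mathrm{S5}_k(\mathcal L)}\varphi$ means that $\varphi$ is derivable from $\Gamma$ and the axioms by these rules. *The semantics $\mathrm{S5}_k([0,1]_{\text{Ł}})$.* Given a non-empty set $X$ and $e\colon X\times Prop\to[0,1]$, define $\|\varphi\|_x\in[0,1]$ for $x\in X$ by $\|p\|_x=e(x,p)$, $\|0\|_x=0$, $\|\varphi*\psi\|_x=\max(\|\varphi\|_x+\|\psi\|_x-1,0)$, $\|\varphi\to\psi\|_x=\min(1-\|\varphi\|_x+\|\psi\|_x,1)$, $\|\square\varphi\|_x=\inf_{y\in X}\|\varphi\|_y$ and $\|\lozenge\varphi\|_x=\sup_{y\in X}\|\varphi\|_y$. The pair $(X,e)$ is a model of $\Gamma\subseteq Fm$ if $\|\varphi\|_x=1$ for all $\varphi\in\Gamma$ and $x\in X$. Write $\Gamma\vDash_{\mathrm{S5}_k([0,1]_{\text{Ł}})}\varphi$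 if every model $(X,e)$ of $\Gamma$ with $|X|\le k$ is a model of $\{\varphi\}$. **Theorem.** $\mathrm{S5}_k(\mathcal L)$ is finitely strongly complete with respect to $\mathrm{S5}_k([0,1]_{\text{Ł}})$: for every finite $\Gamma\subseteq Fm$ and every $\varphi\in Fm$, $$\Gamma\vdash_{\mathrm{S5}_k(\mathcal L)}\varphi\iff\Gamma\vDash_{\mathrm{S5}_k([0,1]_{\text{Ł}})}\varphi .$$ -/

import Mathlib

/-- Formulas of the S5-modal expansion of Basic Logic over the countably infinite set
`{p₀, p₁, …}` of propositional variables. The primitive connectives are those of Hájek's Basic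
Logic (strong conjunction `*`, implication, falsum) together with `□` and `◇`. -/
inductive Fm : Type
  | var : ℕ → Fm
  | bot : Fm
  | imp : Fm → Fm → Fm
  | mul : Fm → Fm → Fm
  | box : Fm → Fm
  | dia : Fm → Fm

namespace Fm

/-- `φ ∧ ψ := φ * (φ → ψ)`. -/
def and (φ ψ : Fm) : Fm := mul φ (imp φ ψ)

/-- `φ ∨ ψ := ((φ → ψ) → ψ) ∧ ((ψ → φ) → φ)`. -/
def or (φ ψ : Fm) : Fm := and (imp (imp φ ψ) ψ) (imp (imp ψ φ) φ)

/-- `¬φ := φ → 0`. -/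
def neg (φ : Fm) : Fm := imp φ bot

/-- `1 := 0 → 0`. -/
def top : Fm := imp bot bot

/-- `φ ≡ ψ := (φ → ψ) ∧ (ψ → φ)`. -/
def equiv (φ ψ : Fm) : Fm := and (imp φ ψ) (imp ψ φ)

/-- The conjunction of a list of formulas; the empty conjunction is `1`. -/
def bigAnd : List Fm → Fm
  | [] => top
  | [φ] => φ
  | φ :: ψ :: l => and φ (bigAnd (ψ :: l))

/-- The disjunction of a list of formulas; the empty disjunction is `0`. -/
def bigOr : List Fm → Fm
  | [] => bot
  | [φ] => φ
  | φ :: ψ :: l => or φ (bigOr (ψ :: l))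

/-- `ν.IsModal` means that `ν` is a propositional combination of formulas that begin with
`□` or `◇`. -/
inductive IsModal : Fm → Prop
  | box (φ : Fm) : IsModal (box φ)
  | dia (φ : Fm) : IsModal (dia φ)
  | bot : IsModal bot
  | imp {μ ν : Fm} : IsModal μ → IsModal ν → IsModal (imp μ ν)
  | mul {μ ν : Fm} : IsModal μ → IsModal ν → IsModal (mul μ ν)

end Fm

open Fm in
/-- Instances (in the modal language) of the axiom schemata of infinite-valued Łukasiewicz logic:
Hájek's axioms of Basic Logic together with `¬¬φ → φ`. -/
inductive LukasiewiczAxiom : Fm → Prop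
  | a1 (φ ψ χ : Fm) : LukasiewiczAxiom (imp (imp φ ψ) (imp (imp ψ χ) (imp φ χ)))
  | a2 (φ ψ : Fm) : LukasiewiczAxiom (imp (mul φ ψ) φ)
  | a3 (φ ψ : Fm) : LukasiewiczAxiom (imp (mul φ ψ) (mul ψ φ))
  | a4 (φ ψ : Fm) : LukasiewiczAxiom (imp (mul φ (imp φ ψ)) (mul ψ (imp ψ φ)))
  | a5a (φ ψ χ : Fm) : LukasiewiczAxiom (imp (imp φ (imp ψ χ)) (imp (mul φ ψ) χ))
  | a5b (φ ψ χ : Fm) : LukasiewiczAxiom (imp (imp (mul φ ψ) χ) (imp φ (imp ψ χ)))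
  | a6 (φ ψ χ : Fm) :
      LukasiewiczAxiom (imp (imp (imp φ ψ) χ) (imp (imp (imp ψ φ) χ) χ))
  | a7 (φ : Fm) : LukasiewiczAxiom (imp bot φ)
  | dne (φ : Fm) : LukasiewiczAxiom (imp (neg (neg φ)) φ)

open Fm in
/-- The axioms of the calculus `S5(Ł)`. -/
inductive S5Axiom : Fm → Prop
  | luk {φ : Fm} : LukasiewiczAxiom φ → S5Axiom φ
  | box_imp (φ : Fm) : S5Axiom (imp (box φ) φ)
  | imp_dia (φ : Fm) : S5Axiom (imp φ (dia φ))
  | box_imp_left (ν φ : Fm) : ν.IsModal → S5Axiom (imp (box (imp ν φ)) (imp ν (box φ)))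
  | box_imp_right (ν φ : Fm) : ν.IsModal → S5Axiom (imp (box (imp φ ν)) (imp (dia φ) ν))
  | box_or (ν φ : Fm) : ν.IsModal → S5Axiom (imp (box (or φ ν)) (or (box φ) ν))
  | dia_mul (φ : Fm) : S5Axiom (equiv (dia (mul φ φ)) (mul (dia φ) (dia φ)))

/-- The instance at `φ₀, …, φₖ` of the width axiom:
`⋀_{i < j} □(φᵢ ∨ φⱼ) → ⋁ᵢ □φᵢ`, with `i, j` ranging over `k + 1` indices. -/
def widthAxiom (k : ℕ) (φ : Fin (k + 1) → Fm) : Fm :=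
  Fm.imp
    (Fm.bigAnd
      (((List.finRange (k + 1) ×ˢ List.finRange (k + 1)).filter (fun p => p.1 < p.2)).map
        (fun p => Fm.box (Fm.or (φ p.1) (φ p.2)))))
    (Fm.bigOr ((List.finRange (k + 1)).map (fun i => Fm.box (φ i))))

/-- The axioms of `S5ₖ(Ł)`. -/
inductive S5WidthAxiom (k : ℕ) : Fm → Prop
  | s5 {φ : Fm} : S5Axiom φ → S5WidthAxiom k φ
  | width (φ : Fin (k + 1) → Fm) : S5WidthAxiom k (widthAxiom k φ)

/-- `S5WidthDerives k Γ φ` is `Γ ⊢ φ` in the calculus `S5ₖ(Ł)`, whose rules are Modus Ponens and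
Necessitation (both applicable to all formulas derived from `Γ`). -/
inductive S5WidthDerives (k : ℕ) (Γ : Set Fm) : Fm → Prop
  | hyp {φ : Fm} : φ ∈ Γ → S5WidthDerives k Γ φ
  | ax {φ : Fm} : S5WidthAxiom k φ → S5WidthDerives k Γ φ
  | mp {φ ψ : Fm} :
      S5WidthDerives k Γ φ → S5WidthDerives k Γ (Fm.imp φ ψ) → S5WidthDerives k Γ ψ
  | nec {φ : Fm} : S5WidthDerives k Γ φ → S5WidthDerives k Γ (Fm.box φ)

/-- The Łukasiewicz t-norm `a * b = max (a + b - 1) 0` on `[0,1]`. -/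
noncomputable def lukMul (a b : unitInterval) : unitInterval :=
  ⟨max ((a : ℝ) + b - 1) 0,
    le_max_right _ _, max_le (by linarith [a.2.2, b.2.2]) zero_le_one⟩

/-- The residuum `a → b = min (1 - a + b) 1` of the Łukasiewicz t-norm. -/
noncomputable def lukImp (a b : unitInterval) : unitInterval :=
  ⟨min (1 - (a : ℝ) + b) 1,
    le_min (by linarith [a.2.2, b.2.1]) zero_le_one, min_le_right _ _⟩

/-- The truth value of a formula at the point `x` of the structure `⟨X, e, [0,1]_Ł⟩`. The infima
and suprema are those of the complete lattice `[0,1]`, so that every structure is safe. -/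
noncomputable def Fm.eval {X : Type*} (e : X → ℕ → unitInterval) : Fm → X → unitInterval
  | var n, x => e x n
  | bot, _ => 0
  | imp φ ψ, x => lukImp (φ.eval e x) (ψ.eval e x)
  | mul φ ψ, x => lukMul (φ.eval e x) (ψ.eval e x)
  | box φ, _ => ⨅ y, φ.eval e y
  | dia φ, _ => ⨆ y, φ.eval e y

/-- The structure `⟨X, e, [0,1]_Ł⟩` is a model of `Γ`. -/
def IsModelOf {X : Type*} (e : X → ℕ → unitInterval) (Γ : Set Fm) : Prop :=
  ∀ φ ∈ Γ, ∀ x, φ.eval e x = 1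

/-- The consequence relation of the logic `S5ₖ([0,1]_Ł)`: every model of `Γ` whose (non-empty)
universe has at most `k` elements is a model of `φ`. -/
def S5WidthEntails (k : ℕ) (Γ : Set Fm) (φ : Fm) : Prop :=
  ∀ (X : Type) [Nonempty X] (e : X → ℕ → unitInterval),
    Cardinal.mk X ≤ (k : Cardinal) → IsModelOf e Γ → IsModelOf e {φ}

/-- Totally ordered MV-algebras, presented as involutive divisible residuated chains. -/
class MVChain (A : Type*) extends LinearOrder A, CommMonoid A where
  bot : A
  imp : A → A → A
  bot_le' (a : A) : bot ≤ a
  le_one' (a : A) : a ≤ 1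
  bot_ne_one : bot ≠ 1
  mul_le_iff (a b c : A) : a * b ≤ c ↔ a ≤ imp b c
  mul_imp_of_le {a b : A} : b ≤ a → a * imp a b = b
  imp_bot_imp_bot (a : A) : imp (imp a bot) bot = a

namespace MVChain

variable {A : Type*} [MVChain A]

/-- Negation. -/
def neg (a : A) : A := imp a bot

/-- Strong disjunction. -/
def oplus (a b : A) : A := imp (neg a) b

theorem neg_neg (a : A) : neg (neg a) = a := imp_bot_imp_bot a

theorem mul_mono {a b c d : A} (h : a ≤ b) (h' : c ≤ d) : a * c ≤ b * d := by
  have h1 : ∀ {a b c : A}, a ≤ b → a * c ≤ b * c := fun {a b c} h =>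
    (mul_le_iff _ _ _).2 (h.trans ((mul_le_iff _ _ _).1 le_rfl))
  calc a * c ≤ b * c := h1 h
    _ = c * b := mul_comm _ _
    _ ≤ d * b := h1 h'
    _ = b * d := mul_comm _ _

theorem mul_le_left' (a b : A) : a * b ≤ a := by
  simpa using mul_mono (le_refl a) (le_one' b)

theorem mul_le_right' (a b : A) : a * b ≤ b := by
  simpa using mul_mono (le_one' a) (le_refl b)

theorem imp_eq_one {a b : A} : imp a b = 1 ↔ a ≤ b := by
  constructor
  · intro h
    have := (mul_le_iff 1 a b).2 h.ge
    simpa using this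
  · intro h
    exact le_antisymm (le_one' _) ((mul_le_iff _ _ _).1 (by simpa using h))

theorem mul_imp_le (a b : A) : a * imp a b ≤ b := by
  rw [mul_comm]; exact (mul_le_iff _ _ _).2 le_rfl

theorem imp_imp (a b c : A) : imp a (imp b c) = imp (a * b) c := by
  apply le_antisymm
  · rw [← mul_le_iff, ← mul_assoc, mul_le_iff, mul_le_iff]
  · rw [← mul_le_iff, ← mul_le_iff, mul_assoc, mul_le_iff]

theorem neg_le_neg {a b : A} (h : a ≤ b) : neg b ≤ neg a := by
  unfold neg
  rw [← mul_le_iff]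
  exact (mul_mono le_rfl h).trans (by rw [mul_comm]; exact mul_imp_le _ _)

theorem neg_mul (a b : A) : neg (a * b) = imp a (neg b) := (imp_imp a b bot).symm

theorem oplus_eq (a b : A) : oplus a b = neg (neg a * neg b) := by
  rw [neg_mul, neg_neg]; rfl

theorem oplus_comm (a b : A) : oplus a b = oplus b a := by
  rw [oplus_eq, oplus_eq, mul_comm]

theorem oplus_assoc (a b c : A) : oplus (oplus a b) c = oplus a (oplus b c) := by
  simp only [oplus_eq, neg_neg, mul_assoc]

theorem oplus_eq_one {a b : A} : oplus a b = 1 ↔ neg a ≤ b := imp_eq_one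

theorem oplus_mono {a b c d : A} (h : a ≤ b) (h' : c ≤ d) : oplus a c ≤ oplus b d := by
  rw [oplus_eq, oplus_eq]
  exact neg_le_neg (mul_mono (neg_le_neg h) (neg_le_neg h'))

theorem neg_one : neg (1 : A) = bot := by
  simpa [neg] using (mul_imp_of_le (bot_le' (1 : A)))

theorem neg_bot : neg (bot : A) = 1 := imp_eq_one.2 le_rfl

theorem bot_oplus (a : A) : oplus bot a = a := by
  rw [oplus_eq, neg_bot, one_mul, neg_neg]

theorem le_oplus_right (a b : A) : b ≤ oplus a b := by
  simpa [bot_oplus] using oplus_mono (bot_le' a) (le_refl b)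

/-- Subtraction recovers a summand of a sum without carry. -/
theorem neg_mul_oplus {a b : A} (h : oplus a b ≠ 1) : neg a * oplus a b = b :=
  mul_imp_of_le (not_le.1 fun h' => h (oplus_eq_one.2 h')).le

theorem neg_mul_oplus' {a b : A} (h : oplus a b ≠ 1) : neg b * oplus a b = a := by
  rw [oplus_comm] at h ⊢; exact neg_mul_oplus h

/-- The dual of divisibility. -/
theorem oplus_neg_mul {a b : A} (h : a ≤ b) : oplus a (neg a * b) = b := by
  have h1 : neg (neg a * b) = imp (neg a) (neg b) := neg_mul _ _
  rw [oplus_eq, h1, mul_imp_of_le (neg_le_neg h), neg_neg]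

/-- Associativity of addition with carry, when the left sum has no carry and the right one has. -/
theorem oplus_mul_assoc {a b c : A} (h : oplus a b ≠ 1) (h' : oplus b c = 1) :
    oplus a (b * c) = oplus a b * c := by
  have hb := neg_mul_oplus h
  have ha : a ≤ oplus a b * c := by
    have h1 : imp (oplus a b) a ≤ c := by
      have h2 : neg b = imp (oplus a b) a := by
        conv_lhs => rw [← hb, mul_comm, neg_mul, neg_neg]
      rw [← h2]; exact oplus_eq_one.1 h'
    have h2 : a ≤ oplus a b := by rw [oplus_comm]; exact le_oplus_right b a
    calc a = oplus a b * imp (oplus a b) a := (mul_imp_of_le h2).symm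
      _ ≤ _ := mul_mono le_rfl h1
  conv_lhs => rw [← hb, mul_assoc]
  exact oplus_neg_mul ha

theorem oplus_mul_of_ne_one {a b c : A} (h : oplus a b ≠ 1) (h' : oplus b c ≠ 1) :
    oplus a b * c = a * oplus b c := by
  conv_lhs => rw [← neg_mul_oplus h']
  conv_rhs => rw [← neg_mul_oplus' h]
  rw [mul_comm (neg b) (oplus a b), mul_assoc]

theorem mul_oplus_of_eq_one {a b c : A} (h : oplus a b = 1) (h' : oplus b c = 1) :
    oplus (a * b) c = oplus a (b * c) := by
  have h1 : oplus (neg b) (b * a) = a := by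
    rw [oplus_comm, oplus_eq_one] at h
    simpa only [neg_neg] using oplus_neg_mul h
  have h2 : oplus (neg b) (b * c) = c := by
    rw [oplus_eq_one] at h'
    simpa only [neg_neg] using oplus_neg_mul h'
  conv_lhs => rw [← h2, ← oplus_assoc, oplus_comm _ (neg b), mul_comm, h1]

end MVChain

section ChangGroup

open MVChain

/-- Chang's group of a totally ordered MV-algebra: an integer part and a fractional part. -/
@[ext]
structure ChangGroup (A : Type*) [MVChain A] where
  int : ℤ
  frac : A
  frac_ne : frac ≠ 1

namespace ChangGroup

variable {A : Type*} [MVChain A]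

theorem mul_ne_one {a b : A} (h : a ≠ 1) : a * b ≠ 1 := fun h' =>
  h (le_antisymm (le_one' a) (h' ▸ MVChain.mul_le_left' a b))

theorem mul_ne_one' {a b : A} (h : b ≠ 1) : a * b ≠ 1 := by
  rw [mul_comm]; exact mul_ne_one h

open Classical in
/-- Addition with carry. -/
instance : Add (ChangGroup A) where
  add x y := if h : oplus x.frac y.frac = 1 then ⟨x.int + y.int + 1, x.frac * y.frac,
    mul_ne_one x.frac_ne⟩ else ⟨x.int + y.int, oplus x.frac y.frac, h⟩

instance : Zero (ChangGroup A) := ⟨⟨0, bot, bot_ne_one⟩⟩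

open Classical in
instance : Neg (ChangGroup A) where
  neg x := if h : neg x.frac = 1 then ⟨-x.int, bot, bot_ne_one⟩ else ⟨-x.int - 1, neg x.frac, h⟩

theorem add_of_eq {x y : ChangGroup A} (h : oplus x.frac y.frac = 1) :
    x + y = ⟨x.int + y.int + 1, x.frac * y.frac, mul_ne_one x.frac_ne⟩ := dif_pos h

theorem add_of_ne {x y : ChangGroup A} (h : oplus x.frac y.frac ≠ 1) :
    x + y = ⟨x.int + y.int, oplus x.frac y.frac, h⟩ := dif_neg h

theorem zero_def : (0 : ChangGroup A) = ⟨0, bot, bot_ne_one⟩ := rfl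

protected theorem add_comm (x y : ChangGroup A) : x + y = y + x := by
  by_cases h : oplus x.frac y.frac = 1
  · rw [add_of_eq h, add_of_eq (by rwa [oplus_comm])]
    ext <;> simp [add_comm, mul_comm]
  · rw [add_of_ne h, add_of_ne (by rwa [oplus_comm])]
    ext <;> simp [add_comm, oplus_comm]

protected theorem add_assoc (x y z : ChangGroup A) : x + y + z = x + (y + z) := by
  obtain ⟨n, a, ha⟩ := x
  obtain ⟨m, b, hb⟩ := y
  obtain ⟨l, c, hc⟩ := z
  have key : ∀ {n m l : ℤ} {a b c : A} (ha : a ≠ 1) (hb : b ≠ 1) (hc : c ≠ 1),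
      oplus a b ≠ 1 → oplus b c = 1 → (⟨n, a, ha⟩ + ⟨m, b, hb⟩ + ⟨l, c, hc⟩ : ChangGroup A) =
        ⟨n, a, ha⟩ + (⟨m, b, hb⟩ + ⟨l, c, hc⟩) := by
    intro n m l a b c ha hb hc h h'
    have h1 := oplus_mul_assoc h h'
    rw [add_of_ne (x := ⟨n, a, ha⟩) (y := ⟨m, b, hb⟩) h,
      add_of_eq (x := ⟨m, b, hb⟩) (y := ⟨l, c, hc⟩) h', add_of_eq, add_of_ne]
    · ext
      · simp only; ring
      · exact h1.symm
    · show oplus a (b * c) ≠ 1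
      rw [h1]; exact mul_ne_one' hc
    · refine le_antisymm (le_one' _) (h' ▸ oplus_mono (le_oplus_right a b) le_rfl)
  by_cases h : oplus a b = 1 <;> by_cases h' : oplus b c = 1
  · have h1 := mul_oplus_of_eq_one h h'
    rw [add_of_eq (x := ⟨n, a, ha⟩) (y := ⟨m, b, hb⟩) h,
      add_of_eq (x := ⟨m, b, hb⟩) (y := ⟨l, c, hc⟩) h']
    by_cases h2 : oplus (a * b) c = 1
    · rw [add_of_eq (by exact h2), add_of_eq (by exact h1 ▸ h2)]
      ext
      · simp only; ring
      · exact mul_assoc _ _ _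
    · rw [add_of_ne (by exact h2), add_of_ne (by exact h1 ▸ h2)]
      ext
      · simp only; ring
      · exact h1
  · have := key (n := l) (m := m) (l := n) hc hb ha (by rwa [oplus_comm]) (by rwa [oplus_comm])
    rw [ChangGroup.add_comm, ChangGroup.add_comm ⟨n, a, ha⟩, ← this,
      ChangGroup.add_comm _ ⟨n, a, ha⟩, ChangGroup.add_comm ⟨l, c, hc⟩ ⟨m, b, hb⟩]
  · exact key ha hb hc h h'
  · rw [add_of_ne (x := ⟨n, a, ha⟩) (y := ⟨m, b, hb⟩) h,
      add_of_ne (x := ⟨m, b, hb⟩) (y := ⟨l, c, hc⟩) h']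
    have h1 := oplus_assoc a b c
    by_cases h2 : oplus (oplus a b) c = 1
    · rw [add_of_eq (by exact h2), add_of_eq (by exact h1 ▸ h2)]
      ext
      · simp only; ring
      · exact oplus_mul_of_ne_one h h'
    · rw [add_of_ne (by exact h2), add_of_ne (by exact h1 ▸ h2)]
      ext
      · simp only; ring
      · exact h1

protected theorem zero_add (x : ChangGroup A) : 0 + x = x := by
  have h : oplus bot x.frac = x.frac := bot_oplus _
  have h1 : oplus (0 : ChangGroup A).frac x.frac ≠ 1 := h.trans_ne x.frac_ne
  rw [add_of_ne h1]
  ext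
  · exact _root_.zero_add _
  · exact h

protected theorem neg_add_cancel (x : ChangGroup A) : -x + x = 0 := by
  by_cases h : MVChain.neg x.frac = 1
  · have hx : x.frac = bot := by rw [← MVChain.neg_neg x.frac, h, neg_one]
    have : -x = ⟨-x.int, bot, bot_ne_one⟩ := dif_pos h
    have h1 : oplus bot x.frac = x.frac := bot_oplus _
    rw [this, add_of_ne (by exact h1.trans_ne x.frac_ne)]
    ext
    · simp [zero_def]
    · exact h1.trans hx
  · have : -x = ⟨-x.int - 1, MVChain.neg x.frac, h⟩ := dif_neg h
    rw [this, add_of_eq (oplus_eq_one.2 (MVChain.neg_neg _).le)]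
    ext
    · show -x.int - 1 + x.int + 1 = 0; ring
    · refine le_antisymm ?_ (bot_le' _)
      show MVChain.neg x.frac * x.frac ≤ bot
      rw [mul_comm]; exact mul_imp_le _ _

instance : AddCommGroup (ChangGroup A) where
  add_assoc := ChangGroup.add_assoc
  zero_add := ChangGroup.zero_add
  add_zero x := by rw [ChangGroup.add_comm, ChangGroup.zero_add]
  neg_add_cancel := ChangGroup.neg_add_cancel
  add_comm := ChangGroup.add_comm
  nsmul := nsmulRec
  zsmul := zsmulRec

/-- The lexicographic order. -/
noncomputable instance : LinearOrder (ChangGroup A) :=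
  LinearOrder.lift' (fun x => toLex (x.int, x.frac)) fun x y h => by
    have := toLex_inj.1 h
    simp only [Prod.mk.injEq] at this
    exact ChangGroup.ext this.1 this.2

theorem le_def {x y : ChangGroup A} : x ≤ y ↔ x.int < y.int ∨ x.int = y.int ∧ x.frac ≤ y.frac :=
  Prod.Lex.toLex_le_toLex

theorem lt_def {x y : ChangGroup A} : x < y ↔ x.int < y.int ∨ x.int = y.int ∧ x.frac < y.frac :=
  Prod.Lex.toLex_lt_toLex

instance : IsOrderedAddMonoid (ChangGroup A) where
  add_le_add_left x y hxy z := by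
    have h1 := MVChain.mul_le_right' x.frac z.frac
    have h2 := le_oplus_right y.frac z.frac
    rw [le_def] at hxy
    by_cases hx : oplus x.frac z.frac = 1 <;> by_cases hy : oplus y.frac z.frac = 1
    · rw [add_of_eq hx, add_of_eq hy, le_def]
      rcases hxy with h | ⟨h, h'⟩
      · left; simp only; omega
      · right; exact ⟨by simp only; omega, mul_mono h' le_rfl⟩
    · rw [add_of_eq hx, add_of_ne hy, le_def]
      rcases hxy with h | ⟨h, h'⟩
      · rcases (show x.int + z.int + 1 ≤ y.int + z.int by omega).lt_or_eq with h | h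
        · exact .inl h
        · exact .inr ⟨h, h1.trans h2⟩
      · exact absurd (le_antisymm (le_one' _) (hx ▸ oplus_mono h' le_rfl)) hy
    · rw [add_of_ne hx, add_of_eq hy, le_def]
      left; simp only; rcases hxy with h | ⟨h, h'⟩ <;> omega
    · rw [add_of_ne hx, add_of_ne hy, le_def]
      rcases hxy with h | ⟨h, h'⟩
      · left; simp only; omega
      · right; exact ⟨by simp only; omega, oplus_mono h' le_rfl⟩

/-- The strong unit. -/
def unit : ChangGroup A := ⟨1, bot, bot_ne_one⟩

open Classical in
/-- The embedding of an MV-chain as the unit interval of its group. -/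
noncomputable def of (a : A) : ChangGroup A := if h : a = 1 then unit else ⟨0, a, h⟩

theorem of_one : of (1 : A) = unit := dif_pos rfl

theorem of_ne {a : A} (h : a ≠ 1) : of a = ⟨0, a, h⟩ := dif_neg h

theorem of_bot : of (bot : A) = 0 := of_ne bot_ne_one

theorem of_nonneg (a : A) : 0 ≤ of a := by
  by_cases h : a = 1
  · subst h; rw [of_one, le_def]; left; exact zero_lt_one
  · rw [of_ne h, le_def]; right; exact ⟨rfl, bot_le' a⟩

theorem unit_pos : 0 < (unit : ChangGroup A) := by
  rw [lt_def]; left; exact zero_lt_one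

theorem of_lt_unit {a : A} (h : a ≠ 1) : of a < unit := by
  rw [of_ne h, lt_def]; left; exact zero_lt_one

theorem of_le_unit (a : A) : of a ≤ unit := by
  by_cases h : a = 1
  · subst h; rw [of_one]
  · exact (of_lt_unit h).le

theorem of_mono {a b : A} (h : a ≤ b) : of a ≤ of b := by
  by_cases hb : b = 1
  · rw [hb, of_one]; exact of_le_unit a
  · have ha : a ≠ 1 := fun h' => hb (le_antisymm (le_one' b) (h' ▸ h))
    rw [of_ne ha, of_ne hb, le_def]; right; exact ⟨rfl, h⟩

theorem of_imp (a b : A) : of (imp a b) = min (unit - of a + of b) unit := by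
  rcases le_or_gt a b with h | h
  · rw [imp_eq_one.2 h, of_one, eq_comm, min_eq_right_iff]
    have := of_mono h
    rw [sub_add_eq_add_sub, le_sub_iff_add_le]
    gcongr
  · have h1 : of (imp a b) = unit - of a + of b := by
      rw [sub_add_eq_add_sub, eq_sub_iff_add_eq]
      by_cases ha : a = 1
      · subst ha
        have : imp 1 b = b := by simpa using mul_imp_of_le h.le
        rw [this, of_one, _root_.add_comm]
      · have hi : imp a b ≠ 1 := fun h' => absurd (imp_eq_one.1 h') (not_le.2 h)
        have hb : b ≠ 1 := fun h' => absurd (le_one' a) (not_le.2 (h' ▸ h))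
        have hc : oplus (imp a b) a = 1 := by
          rw [oplus_comm, oplus_eq_one]
          unfold neg
          rw [← mul_le_iff]
          exact (mul_comm _ _).trans_le ((mul_imp_le _ _).trans (bot_le' _))
        rw [of_ne hi, of_ne ha, of_ne hb, add_of_eq (by exact hc),
          add_of_ne (by rw [unit, bot_oplus]; exact hb)]
        ext
        · simp [unit]
        · simp only [unit, bot_oplus]
          rw [mul_comm]; exact mul_imp_of_le h.le
    rw [← h1, min_eq_left (of_le_unit _)]

theorem of_mul (a b : A) : of (a * b) = max (of a + of b - unit) 0 := by
  have h : a * b = imp (imp a (imp b bot)) bot := by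
    rw [imp_imp]; exact (MVChain.neg_neg _).symm
  have h1 : (unit : ChangGroup A) - of b ≤ unit := sub_le_self _ (of_nonneg b)
  rw [h, of_imp, of_imp, of_imp, of_bot, add_zero, add_zero, min_eq_left h1]
  rw [min_eq_left (sub_le_self _ (le_min (add_nonneg (sub_nonneg.2 (of_le_unit a))
    (sub_nonneg.2 (of_le_unit b))) unit_pos.le))]
  have h2 : unit - (unit - of a + (unit - of b)) = of a + of b - unit := by abel
  rcases le_total (unit - of a + (unit - of b)) unit with h3 | h3
  · rw [min_eq_left h3, h2, max_eq_left (h2 ▸ sub_nonneg.2 h3)]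
  · rw [min_eq_right h3, sub_self, max_eq_right (h2 ▸ sub_nonpos.2 h3)]

/-- Functoriality for embeddings of MV-chains. -/
def map {B : Type*} [MVChain B] (f : A → B) (hf : Function.Injective f) (hbot : f bot = bot)
    (hmul : ∀ a b, f (a * b) = f a * f b) (himp : ∀ a b, f (imp a b) = imp (f a) (f b)) :
    ChangGroup A →+ ChangGroup B :=
  have hone : f 1 = 1 := by
    rw [← imp_eq_one.2 (le_refl (bot : A)), himp]; exact imp_eq_one.2 le_rfl
  have hone' : ∀ {a}, f a = 1 ↔ a = 1 := fun {a} =>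
    ⟨fun h => hf (h.trans hone.symm), fun h => h ▸ hone⟩
  have hop : ∀ a b, f (oplus a b) = oplus (f a) (f b) := fun a b => by
    simp only [oplus, MVChain.neg, himp, hbot]
  { toFun x := ⟨x.int, f x.frac, fun h => x.frac_ne (hone'.1 h)⟩
    map_zero' := ChangGroup.ext rfl hbot
    map_add' x y := by
      by_cases h : oplus x.frac y.frac = 1
      · rw [add_of_eq h, add_of_eq (by show oplus (f _) (f _) = 1; rw [← hop]; exact hone'.2 h)]
        exact ChangGroup.ext rfl (hmul _ _)
      · rw [add_of_ne h, add_of_ne (by show oplus (f _) (f _) ≠ 1; rw [← hop]; exact hone'.not.2 h)]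
        exact ChangGroup.ext rfl (hop _ _) }

section map

variable {B : Type*} [MVChain B] {f : A → B} {hf : Function.Injective f} {hbot : f bot = bot}
    {hmul : ∀ a b, f (a * b) = f a * f b} {himp : ∀ a b, f (imp a b) = imp (f a) (f b)}

theorem map_unit : map f hf hbot hmul himp unit = unit := ChangGroup.ext rfl hbot

theorem map_of (a : A) : map f hf hbot hmul himp (of a) = of (f a) := by
  have hone : f 1 = 1 := by
    rw [← imp_eq_one.2 (le_refl (bot : A)), himp]; exact imp_eq_one.2 le_rfl
  by_cases h : a = 1
  · subst h; rw [of_one, hone, of_one, map_unit]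
  · rw [of_ne h, of_ne fun h' => h (hf (h'.trans hone.symm))]; rfl

theorem map_strictMono : StrictMono (map f hf hbot hmul himp) := by
  have hone : f 1 = 1 := by
    rw [← imp_eq_one.2 (le_refl (bot : A)), himp]; exact imp_eq_one.2 le_rfl
  have hm : StrictMono f := Monotone.strictMono_of_injective (fun a b h => by
    rw [← imp_eq_one, ← himp, imp_eq_one.2 h, hone]) hf
  intro x y h
  rw [lt_def] at h ⊢
  exact h.imp id fun h => ⟨h.1, hm h.2⟩

end map

end ChangGroup

end ChangGroup

/-- An integral form of Gordan's theorem: a finite family in an abelian group without nontrivial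
relations with natural coefficients is strictly positive for some additive map to `ℚ`. -/
theorem exists_addMonoidHom_pos {ι : Type*} (t : Finset ι) {K : Type*} [AddCommGroup K]
    (s : ι → K) (hs : ∀ c : ι → ℕ, ∑ i ∈ t, c i • s i = 0 → ∀ i ∈ t, c i = 0) :
    ∃ f : K →+ ℚ, ∀ i ∈ t, 0 < f (s i) := by
  classical
  induction t using Finset.induction_on generalizing K with
  | empty => exact ⟨0, by simp⟩
  | insert j t hj ih =>
    have hrel : ∀ (c : ι → ℕ) (n : ℕ), ∑ i ∈ t, c i • s i + n • s j = 0 →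
        n = 0 ∧ ∀ i ∈ t, c i = 0 := by
      intro c n h
      have h1 := hs (Function.update c j n) (by
        rw [Finset.sum_insert hj, Function.update_self, add_comm, ← h]
        congr 1
        exact Finset.sum_congr rfl fun i hi => by
          rw [Function.update_of_ne (ne_of_mem_of_not_mem hi hj)])
      refine ⟨by simpa using h1 j (Finset.mem_insert_self _ _), fun i hi => ?_⟩
      simpa [Function.update_of_ne (ne_of_mem_of_not_mem hi hj)] using
        h1 i (Finset.mem_insert_of_mem hi)
    by_cases hq : ∀ c : ι → ℕ, ∑ i ∈ t, c i • (QuotientAddGroup.mk' (AddSubgroup.zmultiples (s j)))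
        (s i) = 0 → ∀ i ∈ t, c i = 0
    · obtain ⟨g, hg⟩ := ih _ hq
      have hinj : Function.Injective (zmultiplesHom K (s j)) := by
        rw [injective_iff_map_eq_zero]
        intro n hn
        rw [zmultiplesHom_apply] at hn
        have h1 : n.natAbs • s j = 0 := by
          rcases Int.natAbs_eq n with h | h
          · rw [h] at hn; simpa using hn
          · rw [h] at hn; simpa using hn
        simpa using (hrel 0 n.natAbs (by simpa using h1)).1
      obtain ⟨h, hh⟩ := (Module.Baer.of_divisible ℚ).extension_property_addMonoidHom
        (zmultiplesHom K (s j)) hinj (Int.castAddHom ℚ)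
      have hh1 : h (s j) = 1 := by
        have := DFunLike.congr_fun hh 1
        simpa using this
      obtain ⟨N, hN⟩ : ∃ N : ℕ, ∀ i ∈ t, 0 < N * g (QuotientAddGroup.mk' _ (s i)) + h (s i) := by
        have : ∀ i : ι, ∃ N : ℕ, i ∈ t →
            ∀ M ≥ N, 0 < M * g (QuotientAddGroup.mk' _ (s i)) + h (s i) := by
          intro i
          by_cases hi : i ∈ t
          · have hp := hg i hi
            obtain ⟨N, hN⟩ := exists_nat_gt (-h (s i) / g (QuotientAddGroup.mk' _ (s i)))
            refine ⟨N, fun _ M hM => ?_⟩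
            rw [div_lt_iff₀ hp] at hN
            have : (N : ℚ) * g (QuotientAddGroup.mk' _ (s i)) ≤
              M * g (QuotientAddGroup.mk' _ (s i)) := by gcongr
            linarith
          · exact ⟨0, fun h => absurd h hi⟩
        choose N hN using this
        exact ⟨t.sup N, fun i hi => hN i hi _ (Finset.le_sup hi)⟩
      refine ⟨N • (g.comp (QuotientAddGroup.mk' _)) + h, fun i hi => ?_⟩
      rcases Finset.mem_insert.1 hi with rfl | hi
      · have : QuotientAddGroup.mk' (AddSubgroup.zmultiples (s i)) (s i) = 0 := by
          simp [AddSubgroup.mem_zmultiples]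
        simp only [AddMonoidHom.add_apply, AddMonoidHom.nsmul_apply, AddMonoidHom.comp_apply, this,
          map_zero, smul_zero, hh1, zero_add, zero_lt_one]
      · simpa using hN i hi
    · push Not at hq
      obtain ⟨c, hc, i, hi, hci⟩ := hq
      have hc' : ∑ i ∈ t, c i • s i ∈ AddSubgroup.zmultiples (s j) := by
        rw [← QuotientAddGroup.eq_zero_iff, ← QuotientAddGroup.mk'_apply, ← hc]
        simp
      obtain ⟨n, hn⟩ := AddSubgroup.mem_zmultiples_iff.1 hc'
      have hn0 : 0 < n := by
        by_contra! h0
        refine hci ((hrel c n.natAbs ?_).2 i hi)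
        rw [← hn, ← natCast_zsmul, ← add_zsmul, show n + (n.natAbs : ℤ) = 0 by omega, zero_zsmul]
      obtain ⟨f, hf⟩ := ih s fun c hc => (hrel c 0 (by simpa using hc)).2
      refine ⟨f, fun k hk => ?_⟩
      rcases Finset.mem_insert.1 hk with rfl | hk
      · have h1 : (n : ℚ) * f (s k) = ∑ i ∈ t, c i * f (s i) := by
          have := congrArg f hn
          simpa using this
        have h2 : 0 < ∑ i ∈ t, c i * f (s i) := Finset.sum_pos' (fun i hi => by
          have := hf i hi; positivity) ⟨i, hi, by have := hf i hi; positivity⟩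
        rw [← h1] at h2
        exact pos_of_mul_pos_right h2 (by exact_mod_cast hn0.le)
      · exact hf k hk

/-- Finitely many elements of ordered abelian groups with a common ordered subgroup
can be mapped to `ℚ` compatibly with their signs and with the common subgroup. -/
theorem exists_addMonoidHom_sign {X : Type*} [Finite X] {G : X → Type*}
    [∀ x, AddCommGroup (G x)] [∀ x, LinearOrder (G x)] [∀ x, IsOrderedAddMonoid (G x)]
    {H : Type*} [AddCommGroup H] [LinearOrder H] [IsOrderedAddMonoid H]
    (ι : ∀ x, H →+ G x) (hι : ∀ x, StrictMono (ι x)) (D : ∀ x, Finset (G x)) :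
    ∃ f : ∀ x, G x →+ ℚ, (∀ x y h, f x (ι x h) = f y (ι y h)) ∧
      ∀ x, ∀ d ∈ D x, SignType.sign (f x d) = SignType.sign d := by
  classical
  have := Fintype.ofFinite X
  let N : AddSubgroup (∀ x, G x) :=
    { carrier := {p | ∃ h : X → H, (∀ x, p x = ι x (h x)) ∧ ∑ x, h x = 0}
      zero_mem' := ⟨0, by simp⟩
      add_mem' := by
        rintro p q ⟨h, hp, h0⟩ ⟨k, hq, k0⟩
        exact ⟨h + k, by simp [hp, hq], by simp [Finset.sum_add_distrib, h0, k0]⟩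
      neg_mem' := by
        rintro p ⟨h, hp, h0⟩
        exact ⟨-h, by simp [hp], by simp [h0]⟩ }
  let i : ∀ x, G x →+ (∀ x, G x) ⧸ N := fun x =>
    (QuotientAddGroup.mk' N).comp (AddMonoidHom.single G x)
  obtain ⟨f, hf⟩ := exists_addMonoidHom_pos (Finset.univ.sigma fun x => (D x).erase 0)
    (fun p : Σ x, G x => i p.1 |p.2|) (by
      intro c hc
      have h1 : ∑ p ∈ Finset.univ.sigma fun x => (D x).erase 0,
          c p • (Pi.single p.1 |p.2| : ∀ x, G x) ∈ N := by
        rw [← QuotientAddGroup.eq_zero_iff, ← QuotientAddGroup.mk'_apply, ← hc, map_sum]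
        rfl
      obtain ⟨h, hh, h0⟩ := h1
      have h2 : ∀ x, ∑ d ∈ (D x).erase 0, c ⟨x, d⟩ • |d| = ι x (h x) := by
        intro x
        rw [← hh x, Finset.sum_sigma, Finset.sum_apply, Finset.sum_eq_single x]
        · simp
        · intro y _ hy
          simp [Pi.single_eq_of_ne' hy]
        · simp
      have h3 : ∀ x, 0 ≤ h x := fun x => by
        rw [← (hι x).le_iff_le, map_zero, ← h2]
        exact Finset.sum_nonneg fun d _ => nsmul_nonneg (abs_nonneg d) _
      have h4 := (Finset.sum_eq_zero_iff_of_nonneg fun x _ => h3 x).1 h0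
      rintro ⟨x, d⟩ hp
      have hd := (Finset.mem_sigma.1 hp).2
      have h5 := h2 x
      rw [h4 x (Finset.mem_univ x), map_zero,
        Finset.sum_eq_zero_iff_of_nonneg fun d _ => nsmul_nonneg (abs_nonneg d) _] at h5
      by_contra hne
      exact (nsmul_pos (abs_pos.2 (Finset.mem_erase.1 hd).1) hne).ne' (h5 d hd))
  refine ⟨fun x => f.comp (i x), fun x y h => ?_, fun x d hd => ?_⟩
  · show f (i x (ι x h)) = f (i y (ι y h))
    congr 1
    rw [← sub_eq_zero]
    show ((Pi.single x (ι x h) - Pi.single y (ι y h) : ∀ x, G x) : (∀ x, G x) ⧸ N) = 0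
    rw [QuotientAddGroup.eq_zero_iff]
    refine ⟨Pi.single x h - Pi.single y h, fun z => ?_, by simp⟩
    simp only [Pi.sub_apply, map_sub]
    congr 1
    · exact (Pi.apply_single (fun z => ι z) (fun z => map_zero _) x h z).symm
    · exact (Pi.apply_single (fun z => ι z) (fun z => map_zero _) y h z).symm
  · show SignType.sign (f (i x d)) = _
    rcases lt_trichotomy d 0 with h | h | h
    · have := hf ⟨x, d⟩ (by simp [hd, h.ne])
      simp only [abs_of_neg h, map_neg] at this
      rw [sign_neg h, sign_neg (by linarith)]
    · simp [h]
    · have := hf ⟨x, d⟩ (by simp [hd, h.ne'])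
      simp only [abs_of_pos h] at this
      rw [sign_pos h, sign_pos this]

/-- Implication of formulas. -/
local infixr:60 " ⇒ " => Fm.imp

open Fm

/-- Sets of formulas containing the Łukasiewicz axioms and closed under Modus Ponens. -/
structure IsFilter (F : Set Fm) : Prop where
  ax {φ : Fm} : LukasiewiczAxiom φ → φ ∈ F
  mp {φ ψ : Fm} : φ ∈ F → φ ⇒ ψ ∈ F → ψ ∈ F

namespace IsFilter

variable {F : Set Fm} (hF : IsFilter F) {a b c d : Fm}
include hF

theorem trans (h : a ⇒ b ∈ F) (h' : b ⇒ c ∈ F) : a ⇒ c ∈ F :=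
  hF.mp h' (hF.mp h (hF.ax (.a1 _ _ _)))

theorem curry (h : mul a b ⇒ c ∈ F) : a ⇒ b ⇒ c ∈ F := hF.mp h (hF.ax (.a5b _ _ _))

theorem uncurry (h : a ⇒ b ⇒ c ∈ F) : mul a b ⇒ c ∈ F := hF.mp h (hF.ax (.a5a _ _ _))

theorem const (a b : Fm) : a ⇒ b ⇒ a ∈ F := hF.curry (hF.ax (.a2 _ _))

theorem weaken (a : Fm) (h : b ∈ F) : a ⇒ b ∈ F := hF.mp h (hF.const _ _)

theorem exchange (a b c : Fm) : (a ⇒ b ⇒ c) ⇒ b ⇒ a ⇒ c ∈ F :=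
  hF.trans (hF.ax (.a5a _ _ _))
    (hF.trans (hF.mp (hF.ax (.a3 b a)) (hF.ax (.a1 _ _ _))) (hF.ax (.a5b _ _ _)))

theorem swap (h : a ⇒ b ⇒ c ∈ F) : b ⇒ a ⇒ c ∈ F := hF.mp h (hF.exchange _ _ _)

theorem refl (a : Fm) : a ⇒ a ∈ F :=
  hF.mp (hF.ax (.a7 bot)) (hF.swap (hF.const a (bot ⇒ bot)))

theorem top_mem : top ∈ F := hF.refl bot

theorem prefixing (a b c : Fm) : (b ⇒ c) ⇒ (a ⇒ b) ⇒ a ⇒ c ∈ F :=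
  hF.swap (hF.ax (.a1 _ _ _))

theorem imp_mono_right (a : Fm) (h : b ⇒ c ∈ F) : (a ⇒ b) ⇒ a ⇒ c ∈ F :=
  hF.mp h (hF.prefixing _ _ _)

theorem imp_mono_left (c : Fm) (h : a ⇒ b ∈ F) : (b ⇒ c) ⇒ a ⇒ c ∈ F :=
  hF.mp h (hF.ax (.a1 _ _ _))

theorem mul_intro (a b : Fm) : a ⇒ b ⇒ mul a b ∈ F := hF.curry (hF.refl _)

theorem mul_mem (ha : a ∈ F) (hb : b ∈ F) : mul a b ∈ F := hF.mp hb (hF.mp ha (hF.mul_intro a b))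

theorem mul_mono (h : a ⇒ b ∈ F) (h' : c ⇒ d ∈ F) : mul a c ⇒ mul b d ∈ F :=
  hF.uncurry (hF.trans h (hF.trans (hF.mul_intro b d) (hF.imp_mono_left _ h')))

theorem mul_assoc_imp (a b c : Fm) : mul (mul a b) c ⇒ mul a (mul b c) ∈ F :=
  hF.uncurry (hF.uncurry (hF.trans (hF.mul_intro a (mul b c)) (hF.ax (.a5b _ _ _))))

theorem imp_mul_assoc (a b c : Fm) : mul a (mul b c) ⇒ mul (mul a b) c ∈ F := by
  refine hF.trans (hF.ax (.a3 _ _)) (hF.trans (hF.mul_mono (hF.ax (.a3 _ _)) (hF.refl _)) ?_)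
  refine hF.trans (hF.mul_assoc_imp _ _ _) (hF.trans (hF.mul_mono (hF.refl _) (hF.ax (.a3 _ _))) ?_)
  exact hF.ax (.a3 _ _)

theorem contrapose (a b : Fm) : (neg b ⇒ neg a) ⇒ a ⇒ b ∈ F :=
  hF.trans (hF.exchange _ _ _) (hF.imp_mono_right _ (hF.ax (.dne _)))

/-- Łukasiewicz's axiom. -/
theorem imp_imp_comm (a b : Fm) : ((a ⇒ b) ⇒ b) ⇒ (b ⇒ a) ⇒ a ∈ F := by
  have h1 : ((a ⇒ b) ⇒ b) ⇒ neg (mul (neg b) (a ⇒ b)) ∈ F :=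
    hF.trans (hF.ax (.a1 _ _ bot)) (hF.ax (.a5a _ _ _))
  have h2 : mul (neg a) (b ⇒ a) ⇒ mul (neg b) (a ⇒ b) ∈ F :=
    hF.trans (hF.mul_mono (hF.refl _) (hF.ax (.a1 b a bot))) (hF.trans (hF.ax (.a4 _ _))
      (hF.mul_mono (hF.refl _) (hF.contrapose _ _)))
  refine hF.trans h1 (hF.trans (hF.imp_mono_left bot h2) ?_)
  exact hF.trans (hF.ax (.a5b _ _ _)) (hF.trans (hF.exchange _ _ _)
    (hF.imp_mono_right _ (hF.ax (.dne _))))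

theorem mem_of_cases (h : (a ⇒ b) ⇒ c ∈ F) (h' : (b ⇒ a) ⇒ c ∈ F) : c ∈ F :=
  hF.mp h' (hF.mp h (hF.ax (.a6 a b c)))

theorem imp_and (h : c ⇒ a ∈ F) (h' : c ⇒ b ∈ F) : c ⇒ Fm.and a b ∈ F := by
  refine hF.mem_of_cases (a := a) (b := b) ?_ ?_
  · exact hF.swap (hF.trans h (hF.mul_intro _ _))
  · exact hF.swap (hF.trans (hF.trans h' (hF.mul_intro _ _))
      (hF.imp_mono_right _ (hF.ax (.a4 b a))))

theorem and_mem (h : a ∈ F) (h' : b ∈ F) : Fm.and a b ∈ F := hF.mul_mem h (hF.weaken _ h')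

theorem and_imp_left (a b : Fm) : Fm.and a b ⇒ a ∈ F := hF.ax (.a2 _ _)

theorem and_imp_right (a b : Fm) : Fm.and a b ⇒ b ∈ F :=
  hF.trans (hF.ax (.a4 _ _)) (hF.ax (.a2 _ _))

theorem imp_or_left (a b : Fm) : a ⇒ Fm.or a b ∈ F :=
  hF.imp_and (hF.swap (hF.refl _)) (hF.const _ _)

theorem imp_or_right (a b : Fm) : b ⇒ Fm.or a b ∈ F :=
  hF.imp_and (hF.const _ _) (hF.swap (hF.refl _))

theorem or_mem_cases (h : a ⇒ b ∈ F ∨ b ⇒ a ∈ F) (h' : Fm.or a b ∈ F) : a ∈ F ∨ b ∈ F := by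
  rcases h with h | h
  · exact .inr (hF.mp h (hF.mp h' (hF.and_imp_left _ _)))
  · exact .inl (hF.mp h (hF.mp h' (hF.and_imp_right _ _)))

theorem bigAnd_mem : ∀ {l : List Fm}, (∀ a ∈ l, a ∈ F) → bigAnd l ∈ F
  | [], _ => hF.top_mem
  | [a], h => h a (by simp)
  | a :: b :: l, h => hF.and_mem (h a (by simp)) (bigAnd_mem fun c hc => h c (by simp [hc]))

theorem imp_bigOr : ∀ {l : List Fm}, a ∈ l → a ⇒ bigOr l ∈ F
  | [b], h => by rw [List.mem_singleton.1 h]; exact hF.refl _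
  | b :: c :: l, h => by
    rcases List.mem_cons.1 h with rfl | h
    · exact hF.imp_or_left _ _
    · exact hF.trans (imp_bigOr h) (hF.imp_or_right _ _)

/-- A formula whose iterated implication belongs to the filter behaves monotonically. -/
theorem iterate_mono (h : b ⇒ c ∈ F) (n : ℕ) : ((a ⇒ ·)^[n] b) ⇒ ((a ⇒ ·)^[n] c) ∈ F := by
  induction n with
  | zero => exact h
  | succ n ih => rw [Function.iterate_succ_apply', Function.iterate_succ_apply']
                 exact hF.imp_mono_right _ ih

theorem imp_iterate (n : ℕ) : c ⇒ ((a ⇒ ·)^[n] c) ∈ F := by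
  induction n with
  | zero => exact hF.refl _
  | succ n ih => rw [Function.iterate_succ_apply']
                 exact hF.trans ih (hF.const _ _)

theorem iterate_exchange (n : ℕ) : ((a ⇒ ·)^[n] (b ⇒ c)) ⇒ b ⇒ ((a ⇒ ·)^[n] c) ∈ F := by
  induction n with
  | zero => exact hF.refl _
  | succ n ih => rw [Function.iterate_succ_apply', Function.iterate_succ_apply']
                 exact hF.trans (hF.imp_mono_right _ ih) (hF.exchange _ _ _)

theorem mem_of_iterate_cases {n m : ℕ} (h : (((a ⇒ b) ⇒ ·)^[n] c) ∈ F)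
    (h' : (((b ⇒ a) ⇒ ·)^[m] c) ∈ F) : c ∈ F := by
  have key : ∀ {c m}, (a ⇒ b) ⇒ c ∈ F → (((b ⇒ a) ⇒ ·)^[m] c) ∈ F → c ∈ F := by
    intro c m h h'
    induction m with
    | zero => exact h'
    | succ m ih =>
      rw [Function.iterate_succ_apply'] at h'
      exact ih (hF.mem_of_cases (hF.trans h (hF.imp_iterate m)) h')
  induction n with
  | zero => exact h
  | succ n ih =>
    rw [Function.iterate_succ_apply'] at h
    exact ih (key h (hF.mp h' (hF.iterate_mono (hF.imp_iterate n) m)))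

end IsFilter

/-- The filter generated by `F` and `a`. -/
def adjoin (F : Set Fm) (a : Fm) : Set Fm := {c | ∃ n, ((a ⇒ ·)^[n] c) ∈ F}

theorem subset_adjoin (F : Set Fm) (a : Fm) : F ⊆ adjoin F a := fun _ h => ⟨0, h⟩

theorem IsFilter.mem_adjoin {F : Set Fm} (hF : IsFilter F) (a : Fm) : a ∈ adjoin F a :=
  ⟨1, hF.refl a⟩

theorem IsFilter.adjoin {F : Set Fm} (hF : IsFilter F) (a : Fm) : IsFilter (adjoin F a) where
  ax h := ⟨0, hF.ax h⟩
  mp := by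
    rintro c d ⟨n, hn⟩ ⟨m, hm⟩
    refine ⟨n + m, ?_⟩
    rw [Function.iterate_add_apply]
    exact hF.mp hn (hF.iterate_mono (hF.mp hm (hF.iterate_exchange m)) n)

/-- Iterated squares `a`, `a * a`, `(a * a) * (a * a)`, … -/
def iterSq (a : Fm) : ℕ → Fm
  | 0 => a
  | n + 1 => mul (iterSq a n) (iterSq a n)

theorem IsFilter.iterSq_imp {F : Set Fm} (hF : IsFilter F) (a : Fm) (n : ℕ) :
    iterSq a n ⇒ a ∈ F := by
  induction n with
  | zero => exact hF.refl a
  | succ n ih => exact hF.trans (hF.ax (.a2 _ _)) ih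

theorem IsFilter.exists_iterSq_imp {F : Set Fm} (hF : IsFilter F) {a c : Fm} (n : ℕ)
    (h : ((a ⇒ ·)^[n] c) ∈ F) : ∃ m, iterSq a m ⇒ c ∈ F := by
  induction n generalizing c with
  | zero => exact ⟨0, hF.weaken _ h⟩
  | succ n ih =>
    rw [Function.iterate_succ_apply] at h
    obtain ⟨m, hm⟩ := ih h
    exact ⟨m + 1, hF.uncurry (hF.trans hm (hF.imp_mono_left _ (hF.iterSq_imp a m)))⟩

/-- Filters that are chains on a set of formulas closed under the propositional connectives. -/
structure ChainFilter where
  carrier : Set Fm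
  filter : Set Fm
  isFilter : IsFilter filter
  bot_mem : bot ∈ carrier
  imp_mem {a b : Fm} : a ∈ carrier → b ∈ carrier → a ⇒ b ∈ carrier
  mul_mem {a b : Fm} : a ∈ carrier → b ∈ carrier → mul a b ∈ carrier
  total {a b : Fm} : a ∈ carrier → b ∈ carrier → a ⇒ b ∈ filter ∨ b ⇒ a ∈ filter
  proper : bot ∉ filter

namespace ChainFilter

/-- Equivalence of formulas modulo a filter. -/
def setoid (p : ChainFilter) : Setoid p.carrier where
  r a b := a.1 ⇒ b.1 ∈ p.filter ∧ b.1 ⇒ a.1 ∈ p.filter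
  iseqv :=
    { refl := fun _ => ⟨p.isFilter.refl _, p.isFilter.refl _⟩
      symm := fun h => ⟨h.2, h.1⟩
      trans := fun h h' => ⟨p.isFilter.trans h.1 h'.1, p.isFilter.trans h'.2 h.2⟩ }

/-- The Lindenbaum algebra of a filter. -/
def Lindenbaum (p : ChainFilter) : Type := Quotient p.setoid

variable {p : ChainFilter}

/-- The class of a formula. -/
def cls (p : ChainFilter) {a : Fm} (ha : a ∈ p.carrier) : p.Lindenbaum :=
  Quotient.mk p.setoid ⟨a, ha⟩

theorem ind {motive : p.Lindenbaum → Prop} (h : ∀ a (ha : a ∈ p.carrier), motive (p.cls ha))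
    (x : p.Lindenbaum) : motive x := Quotient.ind (fun a => h a.1 a.2) x

open Classical in
noncomputable instance : LinearOrder p.Lindenbaum where
  le := Quotient.lift₂ (s₁ := p.setoid) (s₂ := p.setoid) (fun a b => a.1 ⇒ b.1 ∈ p.filter)
    fun _ _ _ _ h h' => propext
      ⟨fun k => p.isFilter.trans h.2 (p.isFilter.trans k h'.1),
        fun k => p.isFilter.trans h.1 (p.isFilter.trans k h'.2)⟩
  le_refl := ind fun a _ => p.isFilter.refl a
  le_trans := ind fun _ _ => ind fun _ _ => ind fun _ _ => p.isFilter.trans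
  le_antisymm := ind fun _ _ => ind fun _ _ h h' => Quotient.sound (s := p.setoid) ⟨h, h'⟩
  le_total := ind fun _ ha => ind fun _ hb => p.total ha hb
  toDecidableLE := Classical.decRel _

instance : Mul p.Lindenbaum where
  mul := Quotient.map₂ (sa := p.setoid) (sb := p.setoid) (sc := p.setoid)
    (fun a b => ⟨mul a.1 b.1, p.mul_mem a.2 b.2⟩)
    fun _ _ h _ _ h' => ⟨p.isFilter.mul_mono h.1 h'.1, p.isFilter.mul_mono h.2 h'.2⟩

noncomputable instance : MVChain p.Lindenbaum where
  mul_assoc := ind fun _ _ => ind fun _ _ => ind fun _ _ => Quotient.sound (s := p.setoid)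
    ⟨p.isFilter.mul_assoc_imp _ _ _, p.isFilter.imp_mul_assoc _ _ _⟩
  mul_comm := ind fun _ _ => ind fun _ _ => Quotient.sound (s := p.setoid)
    ⟨p.isFilter.ax (.a3 _ _), p.isFilter.ax (.a3 _ _)⟩
  one := p.cls (p.imp_mem p.bot_mem p.bot_mem)
  one_mul := ind fun a _ => Quotient.sound (s := p.setoid)
    ⟨p.isFilter.uncurry (p.isFilter.weaken _ (p.isFilter.refl _)),
      p.isFilter.mp p.isFilter.top_mem (p.isFilter.mul_intro _ _)⟩
  mul_one := ind fun a _ => Quotient.sound (s := p.setoid)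
    ⟨p.isFilter.ax (.a2 _ _), p.isFilter.mp p.isFilter.top_mem
      (p.isFilter.swap (p.isFilter.mul_intro _ _))⟩
  bot := p.cls p.bot_mem
  imp := Quotient.map₂ (sa := p.setoid) (sb := p.setoid) (sc := p.setoid)
    (fun a b => ⟨a.1 ⇒ b.1, p.imp_mem a.2 b.2⟩)
    fun _ _ h _ _ h' =>
      ⟨p.isFilter.trans (p.isFilter.imp_mono_left _ h.2) (p.isFilter.imp_mono_right _ h'.1),
        p.isFilter.trans (p.isFilter.imp_mono_left _ h.1) (p.isFilter.imp_mono_right _ h'.2)⟩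
  bot_le' := ind fun _ _ => p.isFilter.ax (.a7 _)
  le_one' := ind fun _ _ => p.isFilter.weaken _ p.isFilter.top_mem
  bot_ne_one h := p.proper (p.isFilter.mp p.isFilter.top_mem
    (Quotient.exact (s := p.setoid) h).2)
  mul_le_iff := ind fun _ _ => ind fun _ _ => ind fun _ _ =>
    ⟨p.isFilter.curry, p.isFilter.uncurry⟩
  mul_imp_of_le {a b} := Quotient.inductionOn₂ (s₁ := p.setoid) (s₂ := p.setoid) a b
    fun _ _ h => Quotient.sound (s := p.setoid) ⟨p.isFilter.and_imp_right _ _,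
      p.isFilter.imp_and h (p.isFilter.refl _)⟩
  imp_bot_imp_bot := ind fun _ _ => Quotient.sound (s := p.setoid)
    ⟨p.isFilter.ax (.dne _), p.isFilter.swap (p.isFilter.refl _)⟩

theorem cls_eq_one {a : Fm} {ha : a ∈ p.carrier} : p.cls ha = 1 ↔ a ∈ p.filter := by
  constructor
  · intro h
    exact p.isFilter.mp p.isFilter.top_mem (Quotient.exact (s := p.setoid) h).2
  · intro h
    exact Quotient.sound (s := p.setoid)
      ⟨p.isFilter.weaken _ p.isFilter.top_mem, p.isFilter.weaken _ h⟩

/-- Inclusions of Lindenbaum algebras. -/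
def lindenbaumMap {p q : ChainFilter} (hC : p.carrier ⊆ q.carrier)
    (hF : ∀ a ∈ p.carrier, a ∈ p.filter ↔ a ∈ q.filter) : p.Lindenbaum → q.Lindenbaum :=
  Quotient.map (sa := p.setoid) (sb := q.setoid) (fun a => ⟨a.1, hC a.2⟩) fun _ _ h =>
    ⟨(hF _ (p.imp_mem (Subtype.prop _) (Subtype.prop _))).1 h.1,
      (hF _ (p.imp_mem (Subtype.prop _) (Subtype.prop _))).1 h.2⟩

/-- The induced map of Chang groups. -/
noncomputable def groupMap {p q : ChainFilter} (hC : p.carrier ⊆ q.carrier)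
    (hF : ∀ a ∈ p.carrier, a ∈ p.filter ↔ a ∈ q.filter) :
    ChangGroup p.Lindenbaum →+ ChangGroup q.Lindenbaum :=
  ChangGroup.map (lindenbaumMap hC hF)
    (ind fun _ ha => ind fun _ hb h => Quotient.sound (s := p.setoid)
      ⟨(hF _ (p.imp_mem ha hb)).2 (Quotient.exact (s := q.setoid) h).1,
        (hF _ (p.imp_mem hb ha)).2 (Quotient.exact (s := q.setoid) h).2⟩)
    rfl (ind fun _ _ => ind fun _ _ => rfl) (ind fun _ _ => ind fun _ _ => rfl)

section groupMap

variable {p q : ChainFilter} (hC : p.carrier ⊆ q.carrier)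
    (hF : ∀ a ∈ p.carrier, a ∈ p.filter ↔ a ∈ q.filter)

theorem groupMap_strictMono : StrictMono (groupMap hC hF) := ChangGroup.map_strictMono

theorem groupMap_unit : groupMap hC hF .unit = .unit := ChangGroup.map_unit

theorem groupMap_of {a : Fm} (ha : a ∈ p.carrier) :
    groupMap hC hF (.of (p.cls ha)) = .of (q.cls (hC ha)) := ChangGroup.map_of _

end groupMap

end ChainFilter

/-- Finitely many formulas can be given real values that behave as in finitely many Lindenbaum
algebras with a common algebra of modal formulas. -/
theorem exists_real_valuation {X : Type*} [Finite X] (p : ChainFilter) (q : X → ChainFilter)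
    (hq : ∀ x, (q x).carrier = Set.univ)
    (hpq : ∀ x, ∀ a ∈ p.carrier, a ∈ p.filter ↔ a ∈ (q x).filter) {S : Set Fm} (hS : S.Finite) :
    ∃ g : X → Fm → ℝ, (∀ x, g x bot = 0) ∧ (∀ x, ∀ a ∈ S, g x a ∈ Set.Icc 0 1) ∧
      (∀ x, ∀ a ∈ S, g x a = 1 ↔ a ∈ (q x).filter) ∧
      (∀ x, ∀ a ∈ S, ∀ b ∈ S, a ⇒ b ∈ (q x).filter → g x a ≤ g x b) ∧
      (∀ x, ∀ a ∈ S, ∀ b ∈ S, g x (a ⇒ b) = min (1 - g x a + g x b) 1) ∧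
      (∀ x, ∀ a ∈ S, ∀ b ∈ S, g x (mul a b) = max (g x a + g x b - 1) 0) ∧
      (∀ x y, ∀ a ∈ p.carrier, g x a = g y a) := by
  classical
  have hm : ∀ x a, a ∈ (q x).carrier := fun x a => by rw [hq]; trivial
  have hC : ∀ x, p.carrier ⊆ (q x).carrier := fun x a _ => hm x a
  let v : ∀ x, Fm → ChangGroup (q x).Lindenbaum := fun x a => .of ((q x).cls (hm x a))
  let D : ∀ x, Finset (ChangGroup (q x).Lindenbaum) := fun x =>
    {.unit} ∪ hS.toFinset.image (v x) ∪ hS.toFinset.image (fun a => .unit - v x a) ∪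
      (hS.toFinset ×ˢ hS.toFinset).image (fun a => v x a.1 - v x a.2) ∪
      (hS.toFinset ×ˢ hS.toFinset).image (fun a => v x a.1 + v x a.2 - .unit)
  obtain ⟨f₀, hf₀, hD⟩ := exists_addMonoidHom_sign
    (fun x => ChainFilter.groupMap (hC x) (hpq x)) (fun x => ChainFilter.groupMap_strictMono _ _) D
  let f : ∀ x, ChangGroup (q x).Lindenbaum →+ ℝ := fun x =>
    (Rat.castHom ℝ).toAddMonoidHom.comp (f₀ x)
  have hf : ∀ x y h, f x (ChainFilter.groupMap (hC x) (hpq x) h) =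
      f y (ChainFilter.groupMap (hC y) (hpq y) h) := fun x y h => congrArg Rat.cast (hf₀ x y h)
  have nonneg_iff : ∀ x, ∀ d ∈ D x, 0 ≤ f x d ↔ 0 ≤ d := fun x d hd => by
    rw [← sign_nonneg_iff (a := d), ← hD x d hd, sign_nonneg_iff]
    exact Rat.cast_nonneg
  have pos_iff : ∀ x, ∀ d ∈ D x, 0 < f x d ↔ 0 < d := fun x d hd => by
    rw [← sign_eq_one_iff (a := d), ← hD x d hd, sign_eq_one_iff]
    exact Rat.cast_pos
  have D0 : ∀ x, .unit ∈ D x := fun x => by simp [D]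
  have D1 : ∀ x, ∀ a ∈ S, v x a ∈ D x := fun x a ha => by
    simp only [D, Finset.mem_union, Finset.mem_image]
    exact .inl (.inl (.inl (.inr ⟨a, by simpa using ha, rfl⟩)))
  have D2 : ∀ x, ∀ a ∈ S, .unit - v x a ∈ D x := fun x a ha => by
    simp only [D, Finset.mem_union, Finset.mem_image]
    exact .inl (.inl (.inr ⟨a, by simpa using ha, rfl⟩))
  have D3 : ∀ x, ∀ a ∈ S, ∀ b ∈ S, v x a - v x b ∈ D x := fun x a ha b hb => by
    simp only [D, Finset.mem_union, Finset.mem_image]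
    exact .inl (.inr ⟨(a, b), by simpa using ⟨ha, hb⟩, rfl⟩)
  have D4 : ∀ x, ∀ a ∈ S, ∀ b ∈ S, v x a + v x b - .unit ∈ D x := fun x a ha b hb => by
    simp only [D, Finset.mem_union, Finset.mem_image]
    exact .inr ⟨(a, b), by simpa using ⟨ha, hb⟩, rfl⟩
  have hu : ∀ x, 0 < f x .unit := fun x => (pos_iff x _ (D0 x)).2 ChangGroup.unit_pos
  have hu' : ∀ x y, f x .unit = f y .unit := fun x y => by
    have := hf x y .unit
    rwa [ChainFilter.groupMap_unit, ChainFilter.groupMap_unit] at this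
  have div_unit : ∀ x (r : ℝ), (r - f x .unit) / f x .unit = r / f x .unit - 1 := fun x r => by
    rw [sub_div, div_self (hu x).ne']
  refine ⟨fun x a => f x (v x a) / f x .unit, fun x => ?_, fun x a ha => ⟨?_, ?_⟩, fun x a ha => ?_,
    fun x a ha b hb h => ?_, fun x a ha b hb => ?_, fun x a ha b hb => ?_, fun x y a ha => ?_⟩
  · have : v x bot = 0 := ChangGroup.of_bot
    simp [this]
  · exact div_nonneg ((nonneg_iff x _ (D1 x a ha)).2 (ChangGroup.of_nonneg _)) (hu x).le
  · rw [div_le_one (hu x), ← sub_nonneg, ← map_sub]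
    exact (nonneg_iff x _ (D2 x a ha)).2 (sub_nonneg.2 (ChangGroup.of_le_unit _))
  · rw [div_eq_one_iff_eq (hu x).ne', ← ChainFilter.cls_eq_one (ha := hm x a)]
    constructor
    · intro h
      by_contra h'
      have h1 := (pos_iff x _ (D2 x a ha)).2 (sub_pos.2 (ChangGroup.of_lt_unit h'))
      rw [map_sub] at h1
      exact (sub_pos.1 h1).ne h
    · intro h
      have : v x a = .unit := by
        show ChangGroup.of _ = _
        rw [h, ChangGroup.of_one]
      rw [this]
  · refine div_le_div_of_nonneg_right ?_ (hu x).le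
    rw [← sub_nonneg, ← map_sub]
    exact (nonneg_iff x _ (D3 x b hb a ha)).2 (sub_nonneg.2 (ChangGroup.of_mono h))
  · have h1 : v x (a ⇒ b) = min (.unit - v x a + v x b) .unit := ChangGroup.of_imp
      ((q x).cls (hm x a)) ((q x).cls (hm x b))
    have h2 := nonneg_iff x _ (D3 x a ha b hb)
    rw [map_sub, sub_nonneg, sub_nonneg] at h2
    have h3 : 1 - f x (v x a) / f x .unit + f x (v x b) / f x .unit =
        f x (.unit - v x a + v x b) / f x .unit := by
      rw [map_add, map_sub, add_div, sub_div, div_self (hu x).ne']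
    simp only [h1, h3]
    rcases le_total (v x b) (v x a) with h | h
    · have h4 : ChangGroup.unit - v x a + v x b ≤ .unit := by
        rw [sub_add_eq_add_sub, sub_le_iff_le_add]; gcongr
      rw [min_eq_left h4, min_eq_left]
      rw [div_le_one (hu x), map_add, map_sub]
      linarith [h2.2 h]
    · have h4 : ChangGroup.unit ≤ .unit - v x a + v x b := by
        rw [sub_add_eq_add_sub, le_sub_iff_add_le]; gcongr
      have h5 := nonneg_iff x _ (D3 x b hb a ha)
      rw [map_sub, sub_nonneg, sub_nonneg] at h5
      rw [min_eq_right h4, div_self (hu x).ne', min_eq_right]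
      rw [one_le_div (hu x), map_add, map_sub]
      linarith [h5.2 h]
  · have h1 : v x (mul a b) = max (v x a + v x b - .unit) 0 := ChangGroup.of_mul
      ((q x).cls (hm x a)) ((q x).cls (hm x b))
    have h2 := nonneg_iff x _ (D4 x a ha b hb)
    have h3 : f x (v x a) / f x .unit + f x (v x b) / f x .unit - 1 =
        f x (v x a + v x b - .unit) / f x .unit := by
      rw [map_sub, map_add, div_unit, add_div]
    simp only [h1, h3]
    rcases le_total 0 (v x a + v x b - .unit) with h | h
    · rw [max_eq_left h, max_eq_left (div_nonneg (h2.2 h) (hu x).le)]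
    · have h4 := (pos_iff x _ (D4 x a ha b hb)).not.2 (not_lt.2 h)
      rw [max_eq_right h, map_zero, zero_div,
        max_eq_right (div_nonpos_of_nonpos_of_nonneg (not_lt.1 h4) (hu x).le)]
  · have h1 := hf x y (.of (p.cls ha))
    rw [ChainFilter.groupMap_of, ChainFilter.groupMap_of] at h1
    show f x (v x a) / _ = f y (v y a) / _
    rw [hu' x y]
    exact congrArg (· / f y .unit) h1

/-- The set of subformulas. -/
def subformulas : Fm → Set Fm
  | var n => {var n}
  | bot => {bot}
  | imp a b => insert (imp a b) (subformulas a ∪ subformulas b)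
  | mul a b => insert (mul a b) (subformulas a ∪ subformulas b)
  | box a => insert (box a) (subformulas a)
  | dia a => insert (dia a) (subformulas a)

theorem subformulas_finite (a : Fm) : (subformulas a).Finite := by
  induction a with
  | var n => exact Set.finite_singleton _
  | bot => exact Set.finite_singleton _
  | imp a b iha ihb => exact (iha.union ihb).insert _
  | mul a b iha ihb => exact (iha.union ihb).insert _
  | box a ih => exact ih.insert _
  | dia a ih => exact ih.insert _

theorem mem_subformulas (a : Fm) : a ∈ subformulas a := by
  cases a <;> simp [subformulas]

/-- The truth lemma: prime filters with the same modal formulas, in which the modalities are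
witnessed, give a model in which finitely many formulas are valid exactly at the filters they
belong to. -/
theorem exists_eval_eq_one_iff {X : Type*} [Finite X] (p : ChainFilter) (q : X → ChainFilter)
    (hq : ∀ x, (q x).carrier = Set.univ) (hp : ∀ a, a ∈ p.carrier ↔ IsModal a)
    (hpq : ∀ x, ∀ a ∈ p.carrier, a ∈ p.filter ↔ a ∈ (q x).filter)
    (box_imp : ∀ x a, box a ⇒ a ∈ (q x).filter) (imp_box : ∀ a, ∃ x, a ⇒ box a ∈ (q x).filter)
    (imp_dia : ∀ x a, a ⇒ dia a ∈ (q x).filter) (dia_imp : ∀ a, ∃ x, dia a ⇒ a ∈ (q x).filter)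
    {S : Set Fm} (hS : S.Finite) :
    ∃ e : X → ℕ → unitInterval, ∀ a ∈ S, ∀ x, a.eval e x = 1 ↔ a ∈ (q x).filter := by
  obtain ⟨g, g_bot, g_mem, g_one, g_mono, g_imp, g_mul, g_modal⟩ := exists_real_valuation p q hq hpq
    (hS.biUnion fun a _ => subformulas_finite a)
  set S' := ⋃ a ∈ S, subformulas a with hS'
  let e : X → ℕ → unitInterval := fun x n => Set.projIcc 0 1 zero_le_one (g x (var n))
  have key : ∀ a, subformulas a ⊆ S' → ∀ x, (a.eval e x : ℝ) = g x a := by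
    intro a
    induction a with
    | var n =>
      intro h x
      have h1 := g_mem x _ (h (mem_subformulas _))
      show ((Set.projIcc (0 : ℝ) 1 zero_le_one (g x (var n)) : unitInterval) : ℝ) = _
      rw [Set.projIcc_of_mem _ h1]
    | bot => intro _ x; rw [g_bot]; rfl
    | imp a b iha ihb =>
      intro h x
      have ha : subformulas a ⊆ S' := fun c hc => h (.inr (.inl hc))
      have hb : subformulas b ⊆ S' := fun c hc => h (.inr (.inr hc))
      rw [g_imp x a (ha (mem_subformulas _)) b (hb (mem_subformulas _)), ← iha ha, ← ihb hb]
      rfl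
    | mul a b iha ihb =>
      intro h x
      have ha : subformulas a ⊆ S' := fun c hc => h (.inr (.inl hc))
      have hb : subformulas b ⊆ S' := fun c hc => h (.inr (.inr hc))
      rw [g_mul x a (ha (mem_subformulas _)) b (hb (mem_subformulas _)), ← iha ha, ← ihb hb]
      rfl
    | box a ih =>
      intro h x
      have ha : subformulas a ⊆ S' := fun c hc => h (.inr hc)
      have ha' := ha (mem_subformulas a)
      have hb := h (mem_subformulas _)
      have hle : ∀ y, g x (box a) ≤ g y a := fun y => by
        rw [g_modal x y _ ((hp _).2 (.box a))]
        exact g_mono y _ hb _ ha' (box_imp y a)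
      obtain ⟨y, hy⟩ := imp_box a
      have hy' : g y a = g x (box a) := le_antisymm (by
        rw [g_modal x y _ ((hp _).2 (.box a))]
        exact g_mono y _ ha' _ hb hy) (hle y)
      have : ⨅ z, a.eval e z = a.eval e y := le_antisymm (iInf_le _ y) (le_iInf fun z => by
        rw [← Subtype.coe_le_coe, ih ha, ih ha, hy']; exact hle z)
      show ((⨅ z, a.eval e z : unitInterval) : ℝ) = _
      rw [this, ih ha, hy']
    | dia a ih =>
      intro h x
      have ha : subformulas a ⊆ S' := fun c hc => h (.inr hc)
      have ha' := ha (mem_subformulas a)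
      have hb := h (mem_subformulas _)
      have hle : ∀ y, g y a ≤ g x (dia a) := fun y => by
        rw [g_modal x y _ ((hp _).2 (.dia a))]
        exact g_mono y _ ha' _ hb (imp_dia y a)
      obtain ⟨y, hy⟩ := dia_imp a
      have hy' : g y a = g x (dia a) := le_antisymm (hle y) (by
        rw [g_modal x y _ ((hp _).2 (.dia a))]
        exact g_mono y _ hb _ ha' hy)
      have : ⨆ z, a.eval e z = a.eval e y := le_antisymm (iSup_le fun z => by
        rw [← Subtype.coe_le_coe, ih ha, ih ha, hy']; exact hle z) (le_iSup (fun z => a.eval e z) y)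
      show ((⨆ z, a.eval e z : unitInterval) : ℝ) = _
      rw [this, ih ha, hy']
  refine ⟨e, fun a ha x => ?_⟩
  have hsub : subformulas a ⊆ S' := Set.subset_biUnion_of_mem (u := subformulas) ha
  rw [← g_one x a (hsub (mem_subformulas a)), ← key a hsub x]
  exact ⟨fun h => by rw [h]; rfl, fun h => Subtype.ext h⟩

/-- Sets of formulas closed under derivability in `S5ₖ(Ł)`. -/
structure IsTheory (k : ℕ) (T : Set Fm) : Prop where
  ax {φ : Fm} : S5WidthAxiom k φ → φ ∈ T
  mp {φ ψ : Fm} : φ ∈ T → φ ⇒ ψ ∈ T → ψ ∈ T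
  nec {φ : Fm} : φ ∈ T → box φ ∈ T

/-- Filters over `T` with the same modal formulas as `T`. -/
structure IsModalConservative (T F : Set Fm) : Prop where
  isFilter : IsFilter F
  subset : T ⊆ F
  mem {ν : Fm} : IsModal ν → ν ∈ F → ν ∈ T

namespace IsTheory

variable {k : ℕ} {T : Set Fm} (hT : IsTheory k T)
include hT

theorem isFilter : IsFilter T := ⟨fun h => hT.ax (.s5 (.luk h)), hT.mp⟩

theorem box_imp_left {ν a : Fm} (hν : IsModal ν) (h : ν ⇒ a ∈ T) : ν ⇒ box a ∈ T :=
  hT.mp (hT.nec h) (hT.ax (.s5 (.box_imp_left ν a hν)))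

theorem box_imp_right {ν a : Fm} (hν : IsModal ν) (h : a ⇒ ν ∈ T) : dia a ⇒ ν ∈ T :=
  hT.mp (hT.nec h) (hT.ax (.s5 (.box_imp_right ν a hν)))

theorem adjoin {ν : Fm} (hν : IsModal ν) : IsTheory k (adjoin T ν) where
  ax h := subset_adjoin _ _ (hT.ax h)
  mp := (hT.isFilter.adjoin ν).mp
  nec := by
    rintro a ⟨n, hn⟩
    have key : box ((ν ⇒ ·)^[n] a) ⇒ ((ν ⇒ ·)^[n] (box a)) ∈ T := by
      clear hn
      induction n with
      | zero => exact hT.isFilter.refl _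
      | succ n ih =>
        rw [Function.iterate_succ_apply', Function.iterate_succ_apply']
        exact hT.isFilter.trans (hT.ax (.s5 (.box_imp_left _ _ hν)))
          (hT.isFilter.imp_mono_right _ ih)
    exact ⟨n, hT.mp (hT.nec hn) key⟩

theorem modal_total {φ : Fm} (hφ : φ ∉ T) (hmax : ∀ T', IsTheory k T' → T ⊆ T' → φ ∉ T' → T' ⊆ T)
    {μ ν : Fm} (hμ : IsModal μ) (hν : IsModal ν) : μ ⇒ ν ∈ T ∨ ν ⇒ μ ∈ T := by
  by_contra! h
  have key : ∀ {a}, IsModal a → a ∉ T → φ ∈ _root_.adjoin T a := fun {a} ha h => by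
    by_contra h'
    exact h (hmax _ (hT.adjoin ha) (subset_adjoin _ _) h' (hT.isFilter.mem_adjoin a))
  obtain ⟨n, hn⟩ := key (hμ.imp hν) h.1
  obtain ⟨m, hm⟩ := key (hν.imp hμ) h.2
  exact hφ (hT.isFilter.mem_of_iterate_cases hn hm)

theorem dia_iterSq {a : Fm} (h : dia a ∈ T) (n : ℕ) : dia (iterSq a n) ∈ T := by
  induction n with
  | zero => exact h
  | succ n ih =>
    exact hT.mp (hT.isFilter.mul_mem ih ih) (hT.mp (hT.ax (.s5 (.dia_mul _)))
      (hT.isFilter.and_imp_right _ _))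

theorem isModalConservative_adjoin {a : Fm} (h : dia a ∈ T) :
    IsModalConservative T (_root_.adjoin T a) where
  isFilter := hT.isFilter.adjoin a
  subset := subset_adjoin _ _
  mem := by
    rintro ν hν ⟨n, hn⟩
    obtain ⟨m, hm⟩ := hT.isFilter.exists_iterSq_imp n hn
    exact hT.mp (hT.dia_iterSq h m) (hT.box_imp_right hν hm)

theorem dia_imp_box (a : Fm) : dia (a ⇒ box a) ∈ T := by
  have hF := hT.isFilter
  set d := dia (a ⇒ box a)
  have h1 : (a ⇒ box a) ⇒ d ∈ T := hT.ax (.s5 (.imp_dia _))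
  have h2 : ((a ⇒ box a) ⇒ box a) ⇒ a ∈ T :=
    hF.mp (hT.ax (.s5 (.box_imp a))) (hF.swap (hF.imp_imp_comm _ _))
  have h3 : (d ⇒ box a) ⇒ box a ∈ T :=
    hT.box_imp_left (.imp (.dia _) (.box _)) (hF.trans (hF.imp_mono_left _ h1) h2)
  exact hF.mp (hF.trans (hF.const _ _) h1) (hF.mp h3 (hF.imp_imp_comm _ _))

theorem dia_dia_imp (a : Fm) : dia (dia a ⇒ a) ∈ T := by
  have hF := hT.isFilter
  set d := dia (dia a ⇒ a)
  have h1 : (dia a ⇒ a) ⇒ d ∈ T := hT.ax (.s5 (.imp_dia _))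
  have h2 : a ⇒ mul (dia a) d ∈ T :=
    hF.trans (hF.imp_and (hT.ax (.s5 (.imp_dia _))) (hF.refl _)) (hF.mul_mono (hF.refl _) h1)
  have h3 : dia a ⇒ mul (dia a) d ∈ T := hT.box_imp_right (.mul (.dia _) (.dia _)) h2
  have h4 : neg (dia a) ⇒ d ∈ T := hF.trans (hF.imp_mono_right _ (hF.ax (.a7 _))) h1
  have h5 : (d ⇒ neg (dia a)) ⇒ neg (dia a) ∈ T :=
    hF.trans (hF.trans (hF.exchange _ _ _) (hF.ax (.a5a _ _ _))) (hF.imp_mono_left bot h3)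
  exact hF.mp h4 (hF.mp h5 (hF.imp_imp_comm _ _))

end IsTheory

theorem exists_maximal_theory {k : ℕ} {T : Set Fm} (hT : IsTheory k T) {φ : Fm} (hφ : φ ∉ T) :
    ∃ M, T ⊆ M ∧ IsTheory k M ∧ φ ∉ M ∧ ∀ T', IsTheory k T' → M ⊆ T' → φ ∉ T' → T' ⊆ M := by
  obtain ⟨M, hTM, hM⟩ := zorn_subset_nonempty {T | IsTheory k T ∧ φ ∉ T} (by
    intro c hc hchain hne
    obtain ⟨T₀, hT₀⟩ := hne
    refine ⟨⋃₀ c, ⟨⟨fun h => ⟨T₀, hT₀, (hc hT₀).1.ax h⟩, ?_, ?_⟩, ?_⟩,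
      fun s hs => Set.subset_sUnion_of_mem hs⟩
    · rintro a b ⟨s, hs, ha⟩ ⟨t, ht, hb⟩
      rcases hchain.total hs ht with h | h
      · exact ⟨t, ht, (hc ht).1.mp (h ha) hb⟩
      · exact ⟨s, hs, (hc hs).1.mp ha (h hb)⟩
    · rintro a ⟨s, hs, ha⟩
      exact ⟨s, hs, (hc hs).1.nec ha⟩
    · rintro ⟨s, hs, h⟩
      exact (hc hs).2 h) T ⟨hT, hφ⟩
  exact ⟨M, hTM, hM.1.1, hM.1.2, fun T' h1 h2 h3 => hM.2 ⟨h1, h3⟩ h2⟩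

theorem IsModalConservative.exists_maximal {T F : Set Fm} (hF : IsModalConservative T F) :
    ∃ M, F ⊆ M ∧ Maximal (IsModalConservative T) M :=
  zorn_subset_nonempty {F | IsModalConservative T F} (by
    intro c hc hchain hne
    obtain ⟨T₀, hT₀⟩ := hne
    refine ⟨⋃₀ c, ⟨⟨fun h => ⟨T₀, hT₀, (hc hT₀).isFilter.ax h⟩, ?_⟩,
      fun a ha => ⟨T₀, hT₀, (hc hT₀).subset ha⟩, ?_⟩, fun s hs => Set.subset_sUnion_of_mem hs⟩
    · rintro a b ⟨s, hs, ha⟩ ⟨t, ht, hb⟩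
      rcases hchain.total hs ht with h | h
      · exact ⟨t, ht, (hc ht).isFilter.mp (h ha) hb⟩
      · exact ⟨s, hs, (hc hs).isFilter.mp ha (h hb)⟩
    · rintro ν hν ⟨s, hs, h⟩
      exact (hc hs).mem hν h) F hF

theorem Maximal.total_of_isModalConservative {T F : Set Fm}
    (hF : Maximal (IsModalConservative T) F)
    (hT : ∀ {μ ν}, IsModal μ → IsModal ν → μ ⇒ ν ∈ T ∨ ν ⇒ μ ∈ T) (a b : Fm) :
    a ⇒ b ∈ F ∨ b ⇒ a ∈ F := by
  have hF' := hF.1.isFilter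
  by_contra! h
  have key : ∀ {c}, c ∉ F → ∃ ν, IsModal ν ∧ ν ∈ adjoin F c ∧ ν ∉ T := fun {c} hc => by
    by_contra! h'
    have h1 : IsModalConservative T (adjoin F c) :=
      ⟨hF'.adjoin c, hF.1.subset.trans (subset_adjoin _ _), fun {ν} h h'' => h' ν h h''⟩
    exact hc (hF.2 h1 (subset_adjoin _ _) (hF'.mem_adjoin c))
  obtain ⟨μ, hμ, ⟨n, hn⟩, hμT⟩ := key h.1
  obtain ⟨ν, hν, ⟨m, hm⟩, hνT⟩ := key h.2
  rcases hT hμ hν with h' | h'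
  · exact hνT (hF.1.mem hν (hF'.mem_of_iterate_cases
      (hF'.mp hn (hF'.iterate_mono (hF.1.subset h') n)) hm))
  · exact hμT (hF.1.mem hμ (hF'.mem_of_iterate_cases hn
      (hF'.mp hm (hF'.iterate_mono (hF.1.subset h') m))))

/-- The width axiom bounds the number of maximal modally conservative filters. -/
theorem IsTheory.card_maximal_le {k : ℕ} {T : Set Fm} (hT : IsTheory k T) (hbot : bot ∉ T)
    (total : ∀ {μ ν}, IsModal μ → IsModal ν → μ ⇒ ν ∈ T ∨ ν ⇒ μ ∈ T) :
    Cardinal.mk {F // Maximal (IsModalConservative T) F} ≤ k := by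
  by_contra! hlt
  have h1 : ((k + 1 : ℕ) : Cardinal) ≤ Cardinal.mk {F // Maximal (IsModalConservative T) F} := by
    rw [Nat.cast_succ]
    exact Cardinal.add_one_le_of_lt hlt
  rw [← Cardinal.mk_fin, Cardinal.le_def] at h1
  obtain ⟨P⟩ := h1
  have hfil : ∀ i, IsFilter (P i).1 := fun i => (P i).2.1.isFilter
  have htot : ∀ i a b, a ⇒ b ∈ (P i).1 ∨ b ⇒ a ∈ (P i).1 := fun i =>
    (P i).2.total_of_isModalConservative total
  have hsep : ∀ i j, ∃ a, i ≠ j → a ∈ (P i).1 ∧ a ∉ (P j).1 := by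
    intro i j
    by_cases hij : i = j
    · exact ⟨bot, fun h => absurd hij h⟩
    · have : ¬ (P i).1 ⊆ (P j).1 := fun h => hij (P.injective (Subtype.ext
        (h.antisymm ((P i).2.2 (P j).2.1 h))))
      obtain ⟨a, ha⟩ := Set.not_subset.1 this
      exact ⟨a, fun _ => ha⟩
  choose a ha using hsep
  let φ : Fin (k + 1) → Fm := fun i =>
    bigOr (((List.finRange (k + 1)).filter (· ≠ i)).map fun j => a i j ⇒ a j i)
  have hnot : ∀ i, φ i ∉ (P i).1 := by
    intro i
    have key : ∀ l : List Fm, (∀ b ∈ l, b ∉ (P i).1) → bigOr l ∉ (P i).1 := by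
      intro l
      induction l with
      | nil => exact fun _ h => hbot ((P i).2.1.mem .bot h)
      | cons b l ih =>
        intro h
        cases l with
        | nil => exact h b (by simp)
        | cons c l =>
          intro h'
          rcases (hfil i).or_mem_cases (htot i _ _) h' with h' | h'
          · exact h b (by simp) h'
          · exact ih (fun d hd => h d (List.mem_cons_of_mem _ hd)) h'
    refine key _ fun b hb => ?_
    simp only [List.mem_map, List.mem_filter, decide_eq_true_eq] at hb
    obtain ⟨j, ⟨-, hj⟩, rfl⟩ := hb
    exact fun h => (ha j i hj).2 ((hfil i).mp (ha i j hj.symm).1 h)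
  have hF := hT.isFilter
  have hor : ∀ {i j}, i ≠ j → Fm.or (φ i) (φ j) ∈ T := by
    intro i j hij
    refine hF.mem_of_cases (a := a i j) (b := a j i) ?_ ?_
    · refine hF.trans (hF.imp_bigOr ?_) (hF.imp_or_left _ _)
      simp only [List.mem_map, List.mem_filter, decide_eq_true_eq]
      exact ⟨j, ⟨by simp, hij.symm⟩, rfl⟩
    · refine hF.trans (hF.imp_bigOr ?_) (hF.imp_or_right _ _)
      simp only [List.mem_map, List.mem_filter, decide_eq_true_eq]
      exact ⟨i, ⟨by simp, hij⟩, rfl⟩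
  have hwidth := hT.mp (hF.bigAnd_mem (by
    intro b hb
    simp only [List.mem_map, List.mem_filter, decide_eq_true_eq] at hb
    obtain ⟨q, ⟨-, hq⟩, rfl⟩ := hb
    exact hT.nec (hor hq.ne))) (hT.ax (.width φ))
  have key : ∀ l : List Fm, bigOr (l.map box) ∈ T → ∃ b ∈ l, box b ∈ T := by
    have hmod : ∀ l : List Fm, IsModal (bigOr (l.map box)) := by
      intro l
      induction l with
      | nil => exact .bot
      | cons b l ih =>
        cases l with
        | nil => exact .box b
        | cons c l =>
          have h := IsModal.box b
          exact .mul (.imp (.imp h ih) ih) (.imp (.imp (.imp h ih) ih) (.imp (.imp ih h) h))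
    intro l
    induction l with
    | nil => exact fun h => absurd h hbot
    | cons b l ih =>
      intro h
      cases l with
      | nil => exact ⟨b, by simp, h⟩
      | cons c l =>
        rcases hF.or_mem_cases (total (.box b) (hmod (c :: l))) h with h | h
        · exact ⟨b, by simp, h⟩
        · obtain ⟨d, hd, h⟩ := ih h
          exact ⟨d, List.mem_cons_of_mem _ hd, h⟩
  obtain ⟨b, hb, hb'⟩ := key ((List.finRange (k + 1)).map φ) (by rw [List.map_map]; exact hwidth)
  obtain ⟨i, -, rfl⟩ := List.mem_map.1 hb
  exact hnot i ((P i).2.1.subset (hT.mp hb' (hT.ax (.s5 (.box_imp _)))))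

theorem S5WidthDerives.of_entails {k : ℕ} {Γ : Set Fm} (hΓ : Γ.Finite) {φ : Fm}
    (h : S5WidthEntails k Γ φ) : S5WidthDerives k Γ φ := by
  by_contra hφ
  obtain ⟨T, hΓT, hT, hφT, hmax⟩ := exists_maximal_theory (T := {ψ | S5WidthDerives k Γ ψ})
    ⟨.ax, .mp, .nec⟩ hφ
  have total : ∀ {μ ν}, IsModal μ → IsModal ν → μ ⇒ ν ∈ T ∨ ν ⇒ μ ∈ T := hT.modal_total hφT hmax
  have hF := hT.isFilter
  have hbot : bot ∉ T := fun h => hφT (hT.mp h (hF.ax (.a7 φ)))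
  let X := {F // Maximal (IsModalConservative T) F}
  have hcard : Cardinal.mk X ≤ k := hT.card_maximal_le hbot total
  have : Finite X := Cardinal.lt_aleph0_iff_finite.1 (hcard.trans_lt (Cardinal.natCast_lt_aleph0))
  have hex : ∀ {a}, dia a ∈ T → ∃ x : X, a ∈ x.1 := fun {a} ha => by
    obtain ⟨M, hM, hM'⟩ := (hT.isModalConservative_adjoin ha).exists_maximal
    exact ⟨⟨M, hM'⟩, hM (hF.mem_adjoin a)⟩
  let p : ChainFilter :=
    { carrier := {ν | IsModal ν}, filter := T, isFilter := hF, bot_mem := .bot, imp_mem := .imp,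
      mul_mem := .mul, total := total, proper := hbot }
  let q : X → ChainFilter := fun x =>
    { carrier := Set.univ, filter := x.1, isFilter := x.2.1.isFilter, bot_mem := trivial,
      imp_mem := fun _ _ => trivial, mul_mem := fun _ _ => trivial,
      total := fun _ _ => x.2.total_of_isModalConservative total _ _,
      proper := fun h => hbot (x.2.1.mem .bot h) }
  obtain ⟨e, he⟩ := exists_eval_eq_one_iff p q (fun _ => rfl) (fun _ => Iff.rfl)
    (fun x a ha => ⟨fun h => x.2.1.subset h, x.2.1.mem ha⟩)
    (fun x a => x.2.1.subset (hT.ax (.s5 (.box_imp a)))) (fun a => hex (hT.dia_imp_box a))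
    (fun x a => x.2.1.subset (hT.ax (.s5 (.imp_dia a)))) (fun a => hex (hT.dia_dia_imp a))
    (hΓ.insert φ)
  obtain ⟨x, hx⟩ := hex (hT.dia_imp_box φ)
  have : Nonempty X := ⟨x⟩
  have h1 := h X e hcard (fun ψ hψ y => (he ψ (.inr hψ) y).2 (y.2.1.subset (hΓT (.hyp hψ)))) φ rfl x
  have h2 : box φ ∈ T := x.2.1.mem (.box φ) (x.2.1.isFilter.mp ((he φ (.inl rfl) x).1 h1) hx)
  exact hφT (hT.mp h2 (hT.ax (.s5 (.box_imp φ))))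

section Soundness

variable {X : Type*} (e : X → ℕ → unitInterval)

theorem eval_imp (a b : Fm) (x : X) :
    ((a ⇒ b).eval e x : ℝ) = min (1 - (a.eval e x : ℝ) + b.eval e x) 1 := rfl

theorem eval_mul (a b : Fm) (x : X) :
    ((mul a b).eval e x : ℝ) = max ((a.eval e x : ℝ) + b.eval e x - 1) 0 := rfl

theorem eval_bot (x : X) : (bot.eval e x : ℝ) = 0 := rfl

theorem eval_and (a b : Fm) (x : X) :
    ((Fm.and a b).eval e x : ℝ) = min (a.eval e x : ℝ) (b.eval e x) := by
  have ha := (a.eval e x).2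
  have hb := (b.eval e x).2
  rw [Fm.and, eval_mul, eval_imp]
  grind

theorem eval_or (a b : Fm) (x : X) :
    ((Fm.or a b).eval e x : ℝ) = max (a.eval e x : ℝ) (b.eval e x) := by
  have ha := (a.eval e x).2
  have hb := (b.eval e x).2
  rw [Fm.or, eval_and, eval_imp, eval_imp, eval_imp, eval_imp]
  grind

theorem eval_eq_one_iff (a : Fm) (x : X) : a.eval e x = 1 ↔ (1 : ℝ) ≤ a.eval e x :=
  ⟨fun h => by rw [h]; rfl, fun h => le_antisymm unitInterval.le_one' h⟩

theorem eval_imp_eq_one_iff (a b : Fm) (x : X) :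
    (a ⇒ b).eval e x = 1 ↔ (a.eval e x : ℝ) ≤ b.eval e x := by
  rw [eval_eq_one_iff, eval_imp, le_min_iff]
  constructor
  · intro h; linarith [h.1]
  · intro h; exact ⟨by linarith, le_rfl⟩

theorem LukasiewiczAxiom.eval_eq_one {a : Fm} (h : LukasiewiczAxiom a) (x : X) :
    a.eval e x = 1 := by
  have hmem : ∀ a : Fm, (0 : ℝ) ≤ a.eval e x ∧ (a.eval e x : ℝ) ≤ 1 := fun a => (a.eval e x).2
  cases h with
  | a1 φ ψ χ =>
    have := hmem φ; have := hmem ψ; have := hmem χ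
    simp only [eval_imp_eq_one_iff, eval_imp]; grind
  | a2 φ ψ =>
    have := hmem φ; have := hmem ψ
    simp only [eval_imp_eq_one_iff, eval_mul]; grind
  | a3 φ ψ =>
    have := hmem φ; have := hmem ψ
    simp only [eval_imp_eq_one_iff, eval_mul]; grind
  | a4 φ ψ =>
    have := hmem φ; have := hmem ψ
    simp only [eval_imp_eq_one_iff, eval_imp, eval_mul]; grind
  | a5a φ ψ χ =>
    have := hmem φ; have := hmem ψ; have := hmem χ
    simp only [eval_imp_eq_one_iff, eval_imp, eval_mul]; grind
  | a5b φ ψ χ =>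
    have := hmem φ; have := hmem ψ; have := hmem χ
    simp only [eval_imp_eq_one_iff, eval_imp, eval_mul]; grind
  | a6 φ ψ χ =>
    have := hmem φ; have := hmem ψ; have := hmem χ
    simp only [eval_imp_eq_one_iff, eval_imp]; grind
  | a7 φ =>
    simp only [eval_imp_eq_one_iff, eval_bot]; exact (hmem φ).1
  | dne φ =>
    have := hmem φ
    simp only [neg, eval_imp_eq_one_iff, eval_imp, eval_bot]; grind

theorem Fm.IsModal.eval_eq {ν : Fm} (h : IsModal ν) (x y : X) : ν.eval e x = ν.eval e y := by
  induction h with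
  | box _ => rfl
  | dia _ => rfl
  | bot => rfl
  | imp _ _ h h' => exact congrArg₂ lukImp h h'
  | mul _ _ h h' => exact congrArg₂ lukMul h h'

theorem eval_bigAnd_le {a : Fm} (x : X) :
    ∀ {l : List Fm}, a ∈ l → ((bigAnd l).eval e x : ℝ) ≤ a.eval e x
  | [b], h => by rw [List.mem_singleton.1 h]; rfl
  | b :: c :: l, h => by
    rw [bigAnd, eval_and]
    rcases List.mem_cons.1 h with rfl | h
    · exact min_le_left _ _
    · exact (min_le_right _ _).trans (eval_bigAnd_le x h)

theorem le_eval_bigOr {a : Fm} (x : X) :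
    ∀ {l : List Fm}, a ∈ l → (a.eval e x : ℝ) ≤ (bigOr l).eval e x
  | [b], h => by rw [List.mem_singleton.1 h]; rfl
  | b :: c :: l, h => by
    rw [bigOr, eval_or]
    rcases List.mem_cons.1 h with rfl | h
    · exact le_max_left _ _
    · exact (le_eval_bigOr x h).trans (le_max_right _ _)

theorem eval_box_le (a : Fm) (x y : X) : ((box a).eval e x : ℝ) ≤ a.eval e y :=
  iInf_le (fun y => a.eval e y) y

theorem le_eval_dia (a : Fm) (x y : X) : (a.eval e y : ℝ) ≤ (dia a).eval e x :=
  le_iSup (fun y => a.eval e y) y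

variable [Finite X] [Nonempty X]

theorem exists_eval_box_eq (a : Fm) : ∃ y, ∀ x, (box a).eval e x = a.eval e y := by
  obtain ⟨y, hy⟩ := exists_eq_ciInf_of_finite (f := fun y => a.eval e y)
  exact ⟨y, fun x => hy.symm⟩

theorem exists_eval_dia_eq (a : Fm) : ∃ y, ∀ x, (dia a).eval e x = a.eval e y := by
  obtain ⟨y, hy⟩ := exists_eq_ciSup_of_finite (f := fun y => a.eval e y)
  exact ⟨y, fun x => hy.symm⟩

theorem S5Axiom.eval_eq_one {a : Fm} (h : S5Axiom a) (x : X) : a.eval e x = 1 := by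
  cases h with
  | luk h => exact h.eval_eq_one e x
  | box_imp a => exact (eval_imp_eq_one_iff e _ _ x).2 (eval_box_le e a x x)
  | imp_dia a => exact (eval_imp_eq_one_iff e _ _ x).2 (le_eval_dia e a x x)
  | box_imp_left ν a hν =>
    obtain ⟨y, hy⟩ := exists_eval_box_eq e a
    have h1 := eval_box_le e (ν ⇒ a) x y
    rw [eval_imp, hν.eval_eq e y x] at h1
    rw [eval_imp_eq_one_iff, eval_imp, hy]
    exact h1
  | box_imp_right ν a hν =>
    obtain ⟨y, hy⟩ := exists_eval_dia_eq e a
    have h1 := eval_box_le e (a ⇒ ν) x y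
    rw [eval_imp, hν.eval_eq e y x] at h1
    rw [eval_imp_eq_one_iff, eval_imp, hy]
    exact h1
  | box_or ν a hν =>
    obtain ⟨y, hy⟩ := exists_eval_box_eq e a
    have h1 := eval_box_le e (Fm.or a ν) x y
    rw [eval_or, hν.eval_eq e y x] at h1
    rw [eval_imp_eq_one_iff, eval_or, hy]
    exact h1
  | dia_mul a =>
    obtain ⟨y, hy⟩ := exists_eval_dia_eq e a
    obtain ⟨z, hz⟩ := exists_eval_dia_eq e (mul a a)
    have h1 := le_eval_dia e (mul a a) x y
    have h2 := le_eval_dia e a x z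
    rw [hy] at h2
    rw [hz, eval_mul, eval_mul] at h1
    rw [equiv, eval_eq_one_iff, eval_and, le_min_iff, ← eval_eq_one_iff, ← eval_eq_one_iff,
      eval_imp_eq_one_iff, eval_imp_eq_one_iff, eval_mul, hy, hz, eval_mul]
    exact ⟨by gcongr, h1⟩

theorem eval_widthAxiom {k : ℕ} (hX : Cardinal.mk X ≤ k) (φ : Fin (k + 1) → Fm) (x : X) :
    (widthAxiom k φ).eval e x = 1 := by
  choose y hy using fun i => exists_eval_box_eq e (φ i)
  have hinj : ¬ Function.Injective y := fun h => by
    have h1 := Cardinal.lift_mk_le_lift_mk_of_injective h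
    rw [Cardinal.mk_fin, Cardinal.lift_natCast] at h1
    have h2 := h1.trans (Cardinal.lift_le.2 hX)
    rw [Cardinal.lift_natCast, Nat.cast_le] at h2
    omega
  obtain ⟨i, j, hij, hlt⟩ : ∃ i j, y i = y j ∧ i < j := by
    simp only [Function.Injective] at hinj
    push Not at hinj
    obtain ⟨i, j, h, hne⟩ := hinj
    rcases lt_or_gt_of_ne hne with h' | h'
    · exact ⟨i, j, h, h'⟩
    · exact ⟨j, i, h.symm, h'⟩
  rw [widthAxiom, eval_imp_eq_one_iff]
  have h1 : (box (Fm.or (φ i) (φ j))) ∈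
      (((List.finRange (k + 1) ×ˢ List.finRange (k + 1)).filter (fun p => p.1 < p.2)).map
        (fun p => box (Fm.or (φ p.1) (φ p.2)))) :=
    List.mem_map.2 ⟨(i, j), by simp [List.mem_filter, hlt], rfl⟩
  have h2 : ∀ i, box (φ i) ∈ (List.finRange (k + 1)).map fun i => box (φ i) := fun i =>
    List.mem_map.2 ⟨i, List.mem_finRange i, rfl⟩
  refine (eval_bigAnd_le e x h1).trans ((eval_box_le e _ x (y i)).trans ?_)
  rw [eval_or, max_le_iff]
  constructor
  · rw [← hy i x]; exact le_eval_bigOr e x (h2 i)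
  · rw [hij, ← hy j x]; exact le_eval_bigOr e x (h2 j)

theorem S5WidthDerives.eval_eq_one {k : ℕ} (hX : Cardinal.mk X ≤ k) {Γ : Set Fm}
    (hΓ : IsModelOf e Γ) {φ : Fm} (h : S5WidthDerives k Γ φ) (x : X) : φ.eval e x = 1 := by
  induction h generalizing x with
  | hyp h => exact hΓ _ h x
  | ax h =>
    cases h with
    | s5 h => exact h.eval_eq_one e x
    | width φ => exact eval_widthAxiom e hX φ x
  | mp _ _ h h' =>
    have h1 := (eval_imp_eq_one_iff e _ _ x).1 (h' x)
    rw [h x] at h1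
    exact (eval_eq_one_iff e _ x).2 h1
  | nec _ h =>
    obtain ⟨y, hy⟩ := exists_eval_box_eq e _
    rw [hy, h]

end Soundness

theorem mainTheorem3 (k : ℕ) (Γ : Set Fm) (hΓ : Γ.Finite) (φ : Fm) :
    S5WidthDerives k Γ φ ↔ S5WidthEntails k Γ φ := by
  refine ⟨fun h X _ e hX hmodel ψ hψ x => ?_, S5WidthDerives.of_entails hΓ⟩
  have : Finite X := Cardinal.lt_aleph0_iff_finite.1 (hX.trans_lt Cardinal.natCast_lt_aleph0)
  rw [Set.mem_singleton_iff.1 hψ]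
  exact h.eval_eq_one e hX hmodel x
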